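/- Let $c,q>0$ and $\kappa>-1$, and let $\varrho:\mathbb R\to[0,\infty)$ be an even probability density that is positive and continuous on $(-c,c)$, vanishes outside $(-c,c)$, and satisfies $\lim_{x\uparrow c}\varrho(x)/|c-x|^{\kappa}=q$. Let $F=(F(x))_{x\in\mathbb Z}$ and $B=(B(i))_{i\in\mathbb Z}$ be two mutually independent families of i.i.d. random variables on a probability space $(\Omega,\mathcal F,\mathbb P)$, where $F(x)$ has density $\varrho$ and $\mathbb P(B(i)=1)=\mathbb P(B(i)=-1)=\tfrac12$. For $n\in\mathbb N$ and an integer $k$ with $|k|\le n$, let $$\bar A(n,k)=\min_{\gamma}\ \sum_{i=1}^{n}F(\gamma(i))\,B(i),$$ the minimum being over all lazy walks from $0$ to $k$ of length $n$, i.e. all $\gamma:\{0,\dots,n\}\to\mathbb Z$ with $\gamma(0)=0$, $\gamma(n)=k$ and $|\gamma(i+1)-\gamma(i)|\le 1$ for $0\le i<n$. Let $[x]$ denote $x$ rounded towards $0$ to an integer. Then there is exactly one deterministic, continuous, even, concave function $\Lambda:[-1,1]\to[0,\infty)$ (the shape function) such that, on one event of probability $1$, $$\frac{\bar A(n,[\alpha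 n])}{n}\longrightarrow-\Lambda(\alpha)\qquad(n\to\infty)\quad\text{for all }\alpha\in[-1,1],$$ and it satisfies $$\Lambda(0)=c,\qquad \Lambda(1)=\Lambda(-1)=0,\qquad \Lambda(\alpha)>c(1-|\alpha|)\quad\text{for }0<|\alpha|<1 .$$ In particular, $\Lambda$ is not an affine function on $[0,1]$. Moreover, there is a constant $K>0$ such that $$\Lambda(\alpha)\le c-K|\alpha|\qquad\text{for all }\alpha\in[-1,1],$$ so that $\Lambda$ has a corner at $0$: its one-sided derivatives at $0$ exist, are finite, and equal $-s$ (right) and $s$ (left) for some $s>0$. -/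

import Mathlib

open Set Filter Topology MeasureTheory ProbabilityTheory

noncomputable section

namespace ProductLPP

/-- Rounding towards `0`. -/
def roundToZero (x : ℝ) : ℤ := if 0 ≤ x then ⌊x⌋ else -⌊-x⌋

/-- The lazy walks `γ : {0, …, n} → ℤ` with `γ 0 = 0` and `γ n = k`. -/
def lazyWalks (n : ℕ) (k : ℤ) : Set (Fin (n + 1) → ℤ) :=
  {γ | γ 0 = 0 ∧ γ (Fin.last n) = k ∧ ∀ i : Fin n, |γ i.succ - γ i.castSucc| ≤ 1}

/-- The action `∑_{i = 1}^n f (γ i) b i` of a path `γ : {0, …, n} → ℤ`. -/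
def action (b f : ℤ → ℝ) {n : ℕ} (γ : Fin (n + 1) → ℤ) : ℝ :=
  ∑ i : Fin n, f (γ i.succ) * b ((i : ℤ) + 1)

/-- The minimal action over the lazy walks from `(0, 0)` to `(n, k)`. For `|k| ≤ n` there are
finitely many of them and at least one, so the infimum is a minimum (`isLeast_minAction`). -/
def minAction (b f : ℤ → ℝ) (n : ℕ) (k : ℤ) : ℝ :=
  sInf (action b f '' lazyWalks n k)

lemma lazyWalks_finite (n : ℕ) (k : ℤ) : (lazyWalks n k).Finite := by
  have key : ∀ γ ∈ lazyWalks n k, ∀ i : Fin (n + 1), |γ i| ≤ (i : ℤ) := by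
    intro γ hγ i
    induction i using Fin.induction with
    | zero => simp [hγ.1]
    | succ i ih =>
      have h := hγ.2.2 i
      rw [abs_le] at h ih ⊢
      simp only [Fin.val_castSucc, Fin.val_succ] at ih ⊢
      push_cast
      constructor <;> linarith [h.1, h.2, ih.1, ih.2]
  refine (Set.Finite.pi' (fun i : Fin (n + 1) => Set.finite_Icc (-(i : ℤ)) (i : ℤ))).subset ?_
  intro γ hγ i
  exact abs_le.mp (key γ hγ i)

lemma lazyWalks_nonempty {n : ℕ} {k : ℤ} (hk : |k| ≤ n) : (lazyWalks n k).Nonempty := by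
  rw [abs_le] at hk
  refine ⟨fun i => max (-(i : ℤ)) (min (i : ℤ) k), ?_, ?_, ?_⟩
  · simp
  · simp only [Fin.val_last]
    omega
  · intro i
    simp only [Fin.val_succ, Fin.val_castSucc]
    rw [abs_le]
    push_cast
    omega

lemma isLeast_minAction (b f : ℤ → ℝ) {n : ℕ} {k : ℤ} (hk : |k| ≤ n) :
    IsLeast (action b f '' lazyWalks n k) (minAction b f n k) := by
  have hne := (lazyWalks_nonempty hk).image (action b f)
  have hfin := (lazyWalks_finite n k).image (action b f)
  exact ⟨hne.csInf_mem hfin, fun _ hx => csInf_le hfin.bddBelow hx⟩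

/-- The requirements on the density `ρ` of the spatial potential: it is even, positive and
continuous on `(-c, c)`, vanishes elsewhere, and `ρ x ~ q (c - x) ^ κ` as `x` tends to `c` inside
the interval. That its total mass is `1` is part of `IsEnvironment`. -/
structure IsSpatialDensity (c κ q : ℝ) (ρ : ℝ → ℝ) : Prop where
  even : ∀ x, ρ (-x) = ρ x
  continuousOn : ContinuousOn ρ (Ioo (-c) c)
  pos : ∀ x ∈ Ioo (-c) c, 0 < ρ x
  eq_zero : ∀ x, x ∉ Ioo (-c) c → ρ x = 0
  edge : Tendsto (fun x => ρ x / |c - x| ^ κ) (𝓝[<] c) (𝓝 q)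

/-- `F` and `B` are independent families of i.i.d. random variables, `F x` has density `ρ` and
`B i` is a fair sign. -/
structure IsEnvironment {Ω : Type*} [MeasurableSpace Ω] (P : Measure Ω) (ρ : ℝ → ℝ)
    (B F : ℤ → Ω → ℝ) : Prop where
  measurable_B : ∀ i, Measurable (B i)
  measurable_F : ∀ x, Measurable (F x)
  iIndep_B : iIndepFun B P
  iIndep_F : iIndepFun F P
  indep : IndepFun (fun ω i => B i ω) (fun ω x => F x ω) P
  law_F : ∀ x, P.map (F x) = volume.withDensity (fun y => ENNReal.ofReal (ρ y))
  prob_B_one : ∀ i, P {ω | B i ω = 1} = 1 / 2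
  prob_B_neg_one : ∀ i, P {ω | B i ω = -1} = 1 / 2

/-- `Λ` (of which only the values on `[-1, 1]` matter) is a shape function of the environment:
a nonnegative, continuous, even, concave deterministic function such that, on one event of full
probability, `-minAction n [α n] / n` tends to `Λ α` for all slopes `α ∈ [-1, 1]` at once. -/
structure IsShapeFunction {Ω : Type*} [MeasurableSpace Ω] (P : Measure Ω)
    (B F : ℤ → Ω → ℝ) (Λ : ℝ → ℝ) : Prop where
  nonneg : ∀ α ∈ Icc (-1 : ℝ) 1, 0 ≤ Λ α
  continuousOn : ContinuousOn Λ (Icc (-1) 1)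
  even : ∀ α ∈ Icc (-1 : ℝ) 1, Λ (-α) = Λ α
  concaveOn : ConcaveOn ℝ (Icc (-1) 1) Λ
  tendsto : ∀ᵐ ω ∂P, ∀ α ∈ Icc (-1 : ℝ) 1,
    Tendsto (fun n : ℕ =>
        minAction (fun i => B i ω) (fun x => F x ω) n (roundToZero (α * n)) / (n : ℝ))
      atTop (𝓝 (-Λ α))

end ProductLPP

end

/-! Existence. Minimal actions are subadditive: concatenating two walks bounds `minAction` at the
sum of the endpoints by two actions, the second in a shifted environment. A shift by `(q, p)` with
`q` and `p` nonzero moves every finite set of coordinates off itself and hence is ergodic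
(`ergodic_reindex`), so the subadditive ergodic theorem `tendsto_of_subadditive` gives deterministic
limits along all nonzero rational slopes. These are countably many, so one event of full probability
serves them all. On that event the other interior slopes, including `0`, follow deterministically:
the point `(n, α n)` is sandwiched between multiples of a lattice vector of nearby slope at times
near `(1 - δ) n` and `(1 + δ) n`, and the connecting stretches cost at most `c` a step
(`exists_eventually_near`). The slopes `1` and `-1` leave no room for this, but are lattice slopes
themselves.

Shape. By bounded convergence `Λ` is also the limit of means, where subadditivity becomes a
deterministic inequality; it yields concavity. The value at `0` is `c`, because with positive
probability two neighbouring sites carry potentials near `c` and `-c`, between which a walk can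
follow the signs. The value at `1` is `0`, since the only walk there is the diagonal, whose action
has mean zero. Continuity at `1` is a matter of entropy: walks of slope near `1` are few, and an
exponential moment bounds their best gain (`neg_meanAction_le`).

Bounds. A walk to `k > 0` visits every site of `(0, k]` and loses at least `c - |F x|` at each,
which gives the linear upper bound and the corner. For the strict lower bound, a walk of `n + 1`
steps to `n` may pause at the start or at the end. The two actions have mean zero and differ by a
sum of order `√n`, so the better one gains more than `c` on average for some `n`
(`exists_meanAction_pause_lt`). One slope thus lies strictly above the chord from `(0, c)` to `(1,
0)`, and concavity lifts the whole open interval. -/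

namespace ProductLPP

/-! ### Ergodicity of coordinate shifts on product spaces. -/

section Ergodic

lemma iterate_reindex {ι E : Type*} (σ : Equiv.Perm ι) (n : ℕ) :
    (fun ω : ι → E => ω ∘ σ)^[n] = fun ω => ω ∘ (σ ^ n : Equiv.Perm ι) := by
  induction n with
  | zero => rfl
  | succ n ih =>
    rw [Function.iterate_succ', ih]
    funext ω i
    simp [pow_succ]

variable {ι E : Type*} [MeasurableSpace E]

lemma measurePreserving_reindex (m : ι → Measure E) [∀ i, IsProbabilityMeasure (m i)]
    (σ : Equiv.Perm ι) (hm : ∀ i, m (σ i) = m i) :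
    MeasurePreserving (fun ω : ι → E => ω ∘ σ) (Measure.infinitePi m) (Measure.infinitePi m) := by
  refine ⟨by fun_prop, ?_⟩
  have h := Measure.map_infinitePi_infinitePi_of_inj (P := m) σ.injective
  simp only [hm] at h
  exact h

/-- A coordinate-permuting map of a product probability space is ergodic as soon as the
permutation moves every finite set of coordinates off itself. -/
theorem ergodic_reindex (m : ι → Measure E) [∀ i, IsProbabilityMeasure (m i)]
    (σ : Equiv.Perm ι) (hm : ∀ i, m (σ i) = m i)
    (hσ : ∀ s : Finset ι, ∃ n : ℕ, ∀ i ∈ s, (σ ^ n : Equiv.Perm ι) i ∉ s) :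
    Ergodic (fun ω : ι → E => ω ∘ σ) (Measure.infinitePi m) := by
  classical
  have hT := measurePreserving_reindex m σ hm
  set μ := Measure.infinitePi m with hμ
  refine ⟨hT, ⟨fun A hA hTA => ?_⟩⟩
  -- A cylinder `C` within `ε` of the invariant set `A` is independent of its preimage under a
  -- suitable iterate. So the square of the measure of `C` is within `2 * ε` of the measure of `A`,
  -- and also within `2 * ε` of its square.
  have key : ∀ ε : ℝ, 0 < ε → |μ.real A - μ.real A * μ.real A| ≤ 4 * ε := by
    intro ε hε
    obtain ⟨C, hC, hCA⟩ := exists_measure_symmDiff_lt_of_generateFrom_isSetRing (μ := μ)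
      (C := measurableCylinders (fun _ : ι => E)) isSetAlgebra_measurableCylinders.isSetRing
      ⟨{univ}, countable_singleton _, by
        simpa using univ_mem_measurableCylinders (fun _ : ι => E), by simp⟩
      generateFrom_measurableCylinders.symm hA (ENNReal.ofReal_pos.2 hε)
    have hCA' : μ.real (symmDiff C A) ≤ ε :=
      ENNReal.toReal_le_of_le_ofReal hε.le hCA.le
    obtain ⟨s, S, hS, rfl⟩ := (mem_measurableCylinders _).1 hC
    obtain ⟨n, hn⟩ := hσ s
    set T := (fun ω : ι → E => ω ∘ σ)^[n] with hTn
    have hTmp : MeasurePreserving T μ μ := hT.iterate n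
    have hTA' : T ⁻¹' A = A := Function.IsFixedPt.preimage_iterate hTA n
    set C : Set (ι → E) := cylinder (α := fun _ => E) s S with hCdef
    have hCm : MeasurableSet C := hS.cylinder s
    have hind : μ.real (C ∩ T ⁻¹' C) = μ.real C * μ.real C := by
      have hdisj : Disjoint s (s.map (σ ^ n : Equiv.Perm ι).toEmbedding) := by
        rw [Finset.disjoint_right]
        intro i hi
        obtain ⟨j, hj, rfl⟩ := Finset.mem_map.1 hi
        exact hn j hj
      have hI := (iIndepFun_infinitePi (P := m) (X := fun _ x => x)
        (fun _ => measurable_id)).indepFun_finset s _ hdisj (fun i => measurable_pi_apply i)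
      let G : ((j : (s.map (σ ^ n : Equiv.Perm ι).toEmbedding)) → E) → (s → E) :=
        fun y i => y ⟨(σ ^ n : Equiv.Perm ι) i, Finset.mem_map_of_mem _ i.2⟩
      have hG : Measurable G := by fun_prop
      have h := hI.measure_inter_preimage_eq_mul S (G ⁻¹' S) hS (hG hS)
      have e2 : T ⁻¹' C = (fun (ω : ι → E) (i : s.map (σ ^ n : Equiv.Perm ι).toEmbedding) =>
          ω i) ⁻¹' (G ⁻¹' S) := by
        rw [hTn, iterate_reindex]
        rfl
      have h2 : μ (C ∩ T ⁻¹' C) = μ C * μ (T ⁻¹' C) := by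
        rw [e2]; exact h
      rw [hTmp.measure_preimage hCm.nullMeasurableSet] at h2
      simp [measureReal_def, h2]
    have h1 : |μ.real C - μ.real A| ≤ ε :=
      (abs_measureReal_sub_le_measureReal_symmDiff
        hCm.nullMeasurableSet hA.nullMeasurableSet).trans hCA'
    have h2 : |μ.real (C ∩ T ⁻¹' C) - μ.real A| ≤ 2 * ε := by
      have h3 : symmDiff (C ∩ T ⁻¹' C) (A ∩ T ⁻¹' A) ⊆ symmDiff C A ∪ T ⁻¹' (symmDiff C A) := by
        intro x hx
        simp only [mem_symmDiff, mem_inter_iff, mem_preimage, mem_union] at hx ⊢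
        tauto
      have h4 : μ.real (T ⁻¹' (symmDiff C A)) = μ.real (symmDiff C A) := by
        simp only [measureReal_def,
          hTmp.measure_preimage (hCm.symmDiff hA).nullMeasurableSet]
      have h5 := abs_measureReal_sub_le_measureReal_symmDiff (μ := μ)
        (hCm.inter (hTmp.measurable hCm)).nullMeasurableSet
        (hA.inter (hTmp.measurable hA)).nullMeasurableSet
      have h6 := (measureReal_mono h3 (measure_ne_top μ _)).trans (measureReal_union_le _ _)
      rw [hTA', inter_self] at h5 h6
      linarith
    have h01 : 0 ≤ μ.real C ∧ μ.real C ≤ 1 := ⟨measureReal_nonneg, measureReal_le_one⟩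
    have h02 : 0 ≤ μ.real A ∧ μ.real A ≤ 1 := ⟨measureReal_nonneg, measureReal_le_one⟩
    rw [hind] at h2
    rw [abs_le] at *
    constructor <;> nlinarith
  have h0 : μ.real A - μ.real A * μ.real A = 0 := by
    by_contra hne
    have := key (|μ.real A - μ.real A * μ.real A| / 8) (by positivity)
    have := abs_pos.2 hne
    linarith
  rw [eventuallyConst_set']
  have h1 : μ.real A = 0 ∨ μ.real A = 1 := by
    have : μ.real A * (1 - μ.real A) = 0 := by linarith
    rcases mul_eq_zero.1 this with h | h
    · exact Or.inl h
    · exact Or.inr (by linarith)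
  rcases h1 with h | h
  · left
    rw [ae_eq_empty]
    exact (measureReal_eq_zero_iff).1 h
  · right
    rw [ae_eq_univ, prob_compl_eq_zero_iff hA]
    rw [measureReal_def, ENNReal.toReal_eq_one_iff] at h
    exact h

end Ergodic

/-! ### The subadditive ergodic theorem. -/

section Kingman

variable {X : Type*}

/-- Greedy covering of an orbit segment: if `T^[i] x` is outside the bad set `A`, some block of
length at most `M` starting there has mean at most `r`; the other steps cost at most `C`. -/
lemma subadditive_greedy_bound {T : X → X} {f : ℕ → X → ℝ} {C r : ℝ} (hC : 0 ≤ C)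
    (hsub : ∀ n m x, f (n + m) x ≤ f n x + f m (T^[n] x)) {A : Set X} {M : ℕ}
    (hA : ∀ x, x ∉ A → ∃ m, 1 ≤ m ∧ m ≤ M ∧ f m x ≤ r * m) (n : ℕ) :
    ∀ x, (∀ i k, f k (T^[i] x) ≤ C * k) →
    f n x ≤ r * n + ∑ i ∈ Finset.range n, (C + |r|) * A.indicator 1 (T^[i] x)
      + (C + |r|) * M := by
  induction n using Nat.strong_induction_on with
  | _ n ih =>
  intro x hx
  have hr := neg_abs_le r
  have hr0 := abs_nonneg r
  have hind : ∀ y, 0 ≤ A.indicator (1 : X → ℝ) y := fun y =>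
    indicator_nonneg (fun _ _ => zero_le_one) y
  have hsum : ∀ (k : ℕ) y, 0 ≤ ∑ i ∈ Finset.range k, (C + |r|) * A.indicator 1 (T^[i] y) :=
    fun k y => Finset.sum_nonneg fun i _ => mul_nonneg (by positivity) (hind _)
  by_cases hnM : n ≤ M
  · have h1 := hx 0 n
    have h2 : (n : ℝ) ≤ M := by exact_mod_cast hnM
    have h3 : (0 : ℝ) ≤ n := by positivity
    have := hsum n x
    simp only [Function.iterate_zero, id] at h1
    nlinarith
  · push Not at hnM
    have step : ∀ m, 1 ≤ m → m ≤ n → f n x ≤ f m x + (r * (n - m : ℕ) +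
        ∑ i ∈ Finset.range (n - m), (C + |r|) * A.indicator 1 (T^[m + i] x) + (C + |r|) * M) := by
      intro m hm1 hmn
      have h1 := hsub m (n - m) x
      rw [Nat.add_sub_cancel' hmn] at h1
      have h2 := ih (n - m) (by omega) (T^[m] x) (fun i k => by
        rw [← Function.iterate_add_apply]; exact hx _ _)
      simp only [← Function.iterate_add_apply] at h2
      simp only [add_comm m]
      linarith
    have split : ∀ m, m ≤ n → ∑ i ∈ Finset.range n, (C + |r|) * A.indicator 1 (T^[i] x) =
        ∑ i ∈ Finset.range m, (C + |r|) * A.indicator 1 (T^[i] x) +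
        ∑ i ∈ Finset.range (n - m), (C + |r|) * A.indicator (1 : X → ℝ) (T^[m + i] x) := by
      intro m hm
      rw [← Finset.sum_range_add, Nat.add_sub_cancel' hm]
    by_cases hxA : x ∈ A
    · have h1 := step 1 le_rfl (by omega)
      have h2 := split 1 (by omega)
      have h3 := hx 0 1
      simp only [Function.iterate_zero, id, Finset.range_one, Finset.sum_singleton,
        indicator_of_mem hxA, Pi.one_apply] at h2 h3
      rw [Nat.cast_sub (by omega)] at h1
      push_cast at h1 h3
      linarith
    · obtain ⟨m, hm1, hmM, hm⟩ := hA x hxA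
      have h1 := step m hm1 (by omega)
      have h2 := split m (by omega)
      have h3 := hsum m x
      rw [Nat.cast_sub (by omega)] at h1
      linarith

/-- The telescoped form of subadditivity that compares with a Birkhoff sum. -/
lemma subadditive_le_birkhoff {T : X → X} {f : ℕ → X → ℝ} {C : ℝ}
    (hsub : ∀ n m x, f (n + m) x ≤ f n x + f m (T^[n] x)) (m n : ℕ) (x : X)
    (hx : ∀ i k, |f k (T^[i] x)| ≤ C * k) :
    m * f (n + m) x ≤ ∑ k ∈ Finset.range n, f m (T^[k] x) + 2 * C * m ^ 2 := by
  -- After summation over `k` the two sums of `f` overlap except for `m` terms at either end. The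
  -- bottom terms are at most `C * m` each, the top ones at least `f (n + m) x - C * m`, whence the
  -- error `2 * C * m ^ 2`.
  have h1 : ∑ k ∈ Finset.range n, f (k + m) x ≤
      ∑ k ∈ Finset.range n, f k x + ∑ k ∈ Finset.range n, f m (T^[k] x) := by
    rw [← Finset.sum_add_distrib]
    exact Finset.sum_le_sum fun k _ => hsub k m x
  have h2 : ∑ k ∈ Finset.range m, f k x + ∑ k ∈ Finset.range n, f (k + m) x =
      ∑ k ∈ Finset.range n, f k x + ∑ j ∈ Finset.range m, f (n + j) x := by
    rw [← Finset.sum_range_add, add_comm n m, Finset.sum_range_add]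
    simp only [add_comm m]
  have hC : 0 ≤ C := by
    have := (abs_nonneg _).trans (hx 0 1)
    simpa using this
  have h3 : ∑ k ∈ Finset.range m, f k x ≤ m * (C * m) := by
    rw [← nsmul_eq_mul]
    refine (Finset.sum_le_card_nsmul _ _ _ fun k hk => ?_).trans_eq (by rw [Finset.card_range])
    have hk' : (k : ℝ) ≤ m := by exact_mod_cast (Finset.mem_range.1 hk).le
    exact ((le_abs_self _).trans (hx 0 k)).trans (by gcongr)
  have h4 : m * (f (n + m) x - C * m) ≤ ∑ j ∈ Finset.range m, f (n + j) x := by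
    rw [← nsmul_eq_mul]
    nth_rw 1 [← Finset.card_range m]
    refine Finset.card_nsmul_le_sum _ _ _ fun j hj => ?_
    have hj' := Finset.mem_range.1 hj
    have h5 := hsub (n + j) (m - j) x
    rw [show n + j + (m - j) = n + m by omega] at h5
    have h6 := (le_abs_self _).trans (hx (n + j) (m - j))
    have h7 : ((m - j : ℕ) : ℝ) ≤ m := by exact_mod_cast Nat.sub_le m j
    have h8 : C * ((m - j : ℕ) : ℝ) ≤ C * m := by gcongr
    linarith
  nlinarith

variable [MeasurableSpace X] {μ : Measure X} [IsProbabilityMeasure μ]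

/-- The lower half of the subadditive ergodic theorem. -/
theorem eventually_ge_of_subadditive {T : X → X} (hT : Ergodic T μ) {f : ℕ → X → ℝ}
    (hf : ∀ n, Measurable (f n)) {C : ℝ} (hC : 0 ≤ C) (hbd : ∀ n, ∀ᵐ x ∂μ, |f n x| ≤ C * n)
    (hsub : ∀ n m x, f (n + m) x ≤ f n x + f m (T^[n] x)) {γ : ℝ}
    (hγ : ∀ n, γ * n ≤ ∫ x, f n x ∂μ) {r : ℝ} (hr : r < γ) :
    ∀ᵐ x ∂μ, ∀ᶠ n : ℕ in atTop, r * n ≤ f n x := by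
  obtain ⟨s, hrs, hsγ⟩ := exists_between hr
  -- The margin `1 / (k + 1)` makes `E` backward invariant: going back from `T x` to `x` adds the
  -- fixed number `f 1 x`, which is absorbed for large `n` when the margin shrinks to `1 / (k + 2)`.
  set E : Set X := {x | ∃ k : ℕ, ∃ᶠ n : ℕ in atTop, f n x ≤ (s - 1 / (k + 1)) * n} with hE
  have hEm : MeasurableSet E := by
    have : E = ⋃ k : ℕ, ⋂ N : ℕ, ⋃ n : ℕ, ⋃ _ : N ≤ n, {x | f n x ≤ (s - 1 / (k + 1)) * n} := by
      ext x
      simp [hE, frequently_atTop]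
    rw [this]
    exact .iUnion fun k => .iInter fun N => .iUnion fun n => .iUnion fun _ =>
      measurableSet_le (hf n) measurable_const
  have hEinv : T ⁻¹' E ⊆ E := by
    rintro x ⟨k, hk⟩
    refine ⟨k + 1, ?_⟩
    have hlim : Tendsto (fun n : ℕ => (1 / ((k : ℝ) + 1) - 1 / ((k + 1 : ℕ) + 1)) * (n : ℝ))
        atTop atTop := by
      refine Tendsto.const_mul_atTop ?_ tendsto_natCast_atTop_atTop
      rw [sub_pos]
      apply one_div_lt_one_div_of_lt <;> push_cast <;> linarith [(Nat.cast_nonneg k : (0:ℝ) ≤ k)]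
    have hev := hlim.eventually_ge_atTop (f 1 x - (s - 1 / ((k + 1 : ℕ) + 1)))
    have h := hk.and_eventually hev
    rw [frequently_atTop] at h ⊢
    intro N
    obtain ⟨n, hn, h1, h2⟩ := h N
    refine ⟨1 + n, by omega, ?_⟩
    have h3 := hsub 1 n x
    simp only [Function.iterate_one] at h3
    push_cast at h1 h2 ⊢
    linarith
  suffices hE0 : μ E = 0 by
    filter_upwards [measure_eq_zero_iff_ae_notMem.1 hE0] with x hx
    obtain ⟨k, hk⟩ := exists_nat_one_div_lt (sub_pos.2 hrs)
    have h1 : ∀ᶠ n : ℕ in atTop, ¬ f n x ≤ (s - 1 / (k + 1)) * n := by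
      by_contra hcon
      exact hx ⟨k, hcon⟩
    filter_upwards [h1] with n hn
    have : (0 : ℝ) ≤ n := by positivity
    push Not at hn
    nlinarith
  rcases hT.ae_empty_or_univ_of_preimage_ae_le' hEm.nullMeasurableSet
    (Eventually.of_forall hEinv) (measure_ne_top _ _) with h | h
  · exact ae_eq_empty.1 h
  exfalso
  -- If `E` had full measure, almost every point would start a block of mean at most `s`. The points
  -- without such a block of length at most `M` then have vanishing measure as `M` grows, and the
  -- greedy covering brings the mean of `f n` below `γ * n`.
  set A : ℕ → Set X := fun M => {x | ∀ m : ℕ, 1 ≤ m → m ≤ M → s * m < f m x} with hAdef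
  have hAm : ∀ M, MeasurableSet (A M) := by
    intro M
    have : A M = ⋂ m : ℕ, ⋂ _ : 1 ≤ m, ⋂ _ : m ≤ M, {x | s * m < f m x} := by
      ext x
      simp [hAdef]
    rw [this]
    exact .iInter fun m => .iInter fun _ => .iInter fun _ =>
      measurableSet_lt measurable_const (hf m)
  have hAanti : Antitone A := fun M N hMN x hx m h1 h2 => hx m h1 (h2.trans hMN)
  have hAnull : μ (⋂ M, A M) = 0 := by
    refine measure_mono_null (fun x hx => ?_) (ae_eq_univ.1 h)
    rintro ⟨k, hk⟩
    obtain ⟨n, h1, h2⟩ := frequently_atTop.1 hk 1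
    have h3 := mem_iInter.1 hx n n h1 le_rfl
    have h4 : (0 : ℝ) < 1 / (k + 1) := by positivity
    have h5 : (0 : ℝ) ≤ n := by positivity
    nlinarith
  have hAlim : Tendsto (fun M => μ.real (A M)) atTop (𝓝 0) := by
    have h1 := tendsto_measure_iInter_atTop (μ := μ) (fun M => (hAm M).nullMeasurableSet) hAanti
      ⟨0, measure_ne_top _ _⟩
    rw [hAnull] at h1
    have h2 := (ENNReal.tendsto_toReal ENNReal.zero_ne_top).comp h1
    rw [ENNReal.toReal_zero] at h2
    exact h2
  set D := C + |s| with hD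
  have hD0 : 0 ≤ D := by positivity
  have hbound : ∀ M n : ℕ, γ * n ≤ s * n + n * (D * μ.real (A M)) + D * M := by
    intro M n
    refine (hγ n).trans ?_
    have hall : ∀ᵐ x ∂μ, ∀ i k, f k (T^[i] x) ≤ C * k := by
      rw [ae_all_iff]; intro i
      rw [ae_all_iff]; intro k
      filter_upwards [(hT.toMeasurePreserving.iterate i).quasiMeasurePreserving.ae (hbd k)]
        with x hx using (le_abs_self _).trans hx
    have hgi : ∀ i, Integrable (fun x => (A M).indicator (1 : X → ℝ) (T^[i] x)) μ := fun i =>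
      ((hT.toMeasurePreserving.iterate i).integrable_comp_of_integrable
        ((integrable_const (1 : ℝ)).indicator (hAm M)))
    have hsumi : Integrable
        (fun x => ∑ i ∈ Finset.range n, D * (A M).indicator (1 : X → ℝ) (T^[i] x)) μ :=
      integrable_finsetSum _ fun i _ => (hgi i).const_mul D
    calc ∫ x, f n x ∂μ ≤ ∫ x, (s * n + ∑ i ∈ Finset.range n,
          D * (A M).indicator (1 : X → ℝ) (T^[i] x)) + D * M ∂μ := by
          refine integral_mono_ae ?_ ?_ ?_
          · exact Integrable.of_bound (hf n).aestronglyMeasurable (C * n) (hbd n)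
          · exact ((integrable_const _).add hsumi).add (integrable_const _)
          · filter_upwards [hall] with x hx
            refine subadditive_greedy_bound hC hsub (fun y hy => ?_) n x hx
            simp only [hAdef, mem_ofPred_eq] at hy
            push Not at hy
            exact hy
      _ = s * n + n * (D * μ.real (A M)) + D * M := by
          rw [integral_add (f := fun x => s * n + ∑ i ∈ Finset.range n,
              D * (A M).indicator (1 : X → ℝ) (T^[i] x))
              ((integrable_const _).add hsumi) (integrable_const _),
            integral_add (integrable_const _) hsumi,
            integral_finsetSum _ fun i _ => (hgi i).const_mul D]
          have : ∀ i, ∫ x, D * (A M).indicator (1 : X → ℝ) (T^[i] x) ∂μ = D * μ.real (A M) := by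
            intro i
            have hmp := hT.toMeasurePreserving.iterate i
            have h1 : (fun x => (A M).indicator (1 : X → ℝ) (T^[i] x)) =
                (T^[i] ⁻¹' A M).indicator 1 := by
              ext x; rfl
            rw [integral_const_mul, h1, integral_indicator_one (hmp.measurable (hAm M)),
              measureReal_def, hmp.measure_preimage (hAm M).nullMeasurableSet]
            rfl
          simp [this]
  have hlim2 : Tendsto (fun M => D * μ.real (A M)) atTop (𝓝 0) := by
    simpa using hAlim.const_mul D
  obtain ⟨M, hM⟩ := (hlim2.eventually_lt_const (half_pos (sub_pos.2 hsγ))).exists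
  obtain ⟨n, hn⟩ := exists_nat_gt (D * M / ((γ - s) / 2))
  rw [div_lt_iff₀ (by linarith)] at hn
  have h1 := hbound M n
  have h2 : (0 : ℝ) ≤ n := by positivity
  nlinarith

/-- The subadditive ergodic theorem for linearly bounded processes over an ergodic map. -/
theorem tendsto_of_subadditive {T : X → X} (hT : Ergodic T μ) {f : ℕ → X → ℝ}
    (hf : ∀ n, Measurable (f n)) {C : ℝ} (hC : 0 ≤ C) (hbd : ∀ n, ∀ᵐ x ∂μ, |f n x| ≤ C * n)
    (hf0 : ∀ x, f 0 x = 0)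
    (hsub : ∀ n m x, f (n + m) x ≤ f n x + f m (T^[n] x)) :
    ∃ l : ℝ, ∀ᵐ x ∂μ, Tendsto (fun n : ℕ => f n x / n) atTop (𝓝 l) := by
  have hfi : ∀ n, Integrable (f n) μ := fun n =>
    Integrable.of_bound (hf n).aestronglyMeasurable (C * n) (hbd n)
  have hint : ∀ n, |∫ x, f n x ∂μ| ≤ C * n := by
    intro n
    have := norm_integral_le_of_norm_le_const (μ := μ) (f := f n) (hbd n)
    simpa using this
  have hbelow : BddBelow (range fun m : ℕ => (∫ x, f (m + 1) x ∂μ) / ((m + 1 : ℕ) : ℝ)) := by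
    refine ⟨-C, ?_⟩
    rintro _ ⟨m, rfl⟩
    have h1 := neg_le_of_abs_le (hint (m + 1))
    have h2 : (0 : ℝ) < ((m + 1 : ℕ) : ℝ) := by positivity
    simp only
    rw [le_div_iff₀ h2]
    linarith
  set γ := ⨅ m : ℕ, (∫ x, f (m + 1) x ∂μ) / ((m + 1 : ℕ) : ℝ) with hγdef
  have hγ : ∀ n : ℕ, γ * n ≤ ∫ x, f n x ∂μ := by
    intro n
    cases n with
    | zero => simp [hf0]
    | succ n =>
      have h2 : (0 : ℝ) < ((n + 1 : ℕ) : ℝ) := by positivity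
      rw [← le_div_iff₀ h2]
      exact ciInf_le hbelow n
  have hlow : ∀ᵐ x ∂μ, ∀ k : ℕ, ∀ᶠ n : ℕ in atTop, (γ - 1 / (k + 1)) * n ≤ f n x := by
    rw [ae_all_iff]
    intro k
    refine eventually_ge_of_subadditive hT hf hC hbd hsub hγ ?_
    have : (0 : ℝ) < 1 / (k + 1) := by positivity
    linarith
  have hup : ∀ᵐ x ∂μ, ∀ m k : ℕ, ∀ᶠ n : ℕ in atTop,
      ∑ i ∈ Finset.range n, f m (T^[i] x) ≤ (∫ x, f m x ∂μ + 1 / (k + 1)) * n := by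
    rw [ae_all_iff]; intro m
    rw [ae_all_iff]; intro k
    have hmeas : ∀ n : ℕ, Measurable fun x => -∑ i ∈ Finset.range n, f m (T^[i] x) := fun n =>
      (Finset.measurable_sum _ fun i _ => (hf m).comp (hT.measurable.iterate i)).neg
    have hk : (0 : ℝ) < 1 / (k + 1) := by positivity
    -- The negated Birkhoff sums of `f m` form an additive process, so the lower half already
    -- contains the upper bound of Birkhoff's theorem.
    have h := eventually_ge_of_subadditive hT (C := C * m) hmeas (by positivity) (fun n => ?_)
      (fun n n' x => ?_) (γ := -∫ x, f m x ∂μ) (fun n => ?_)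
      (r := -∫ x, f m x ∂μ - 1 / (k + 1)) (by linarith)
    · filter_upwards [h] with x hx
      filter_upwards [hx] with n hn
      linarith
    · have : ∀ᵐ x ∂μ, ∀ i, |f m (T^[i] x)| ≤ C * m := by
        rw [ae_all_iff]
        exact fun i => (hT.toMeasurePreserving.iterate i).quasiMeasurePreserving.ae (hbd m)
      filter_upwards [this] with x hx
      rw [abs_neg]
      refine (Finset.abs_sum_le_sum_abs _ _).trans ?_
      refine (Finset.sum_le_card_nsmul _ _ (C * m) fun i _ => hx i).trans_eq ?_
      rw [Finset.card_range, nsmul_eq_mul]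
      ring
    · rw [Finset.sum_range_add]
      simp only [← Function.iterate_add_apply, add_comm n]
      linarith
    · rw [integral_neg, integral_finsetSum]
      · have : ∀ i, ∫ x, f m (T^[i] x) ∂μ = ∫ x, f m x ∂μ := fun i => by
          have hmp := hT.toMeasurePreserving.iterate i
          rw [← integral_map hmp.measurable.aemeasurable (hf m).aestronglyMeasurable, hmp.map_eq]
        simp only [this, Finset.sum_const, Finset.card_range, nsmul_eq_mul]
        linarith
      · intro i _
        exact (hT.toMeasurePreserving.iterate i).integrable_comp_of_integrable (hfi m)
  have hall : ∀ᵐ x ∂μ, ∀ i k, |f k (T^[i] x)| ≤ C * k := by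
    rw [ae_all_iff]; intro i
    rw [ae_all_iff]; intro k
    exact (hT.toMeasurePreserving.iterate i).quasiMeasurePreserving.ae (hbd k)
  refine ⟨γ, ?_⟩
  filter_upwards [hlow, hup, hall] with x hx1 hx2 hx3
  rw [tendsto_order]
  constructor
  · intro a ha
    obtain ⟨k, hk⟩ := exists_nat_one_div_lt (sub_pos.2 ha)
    filter_upwards [hx1 k, eventually_gt_atTop 0] with n hn hn0
    have hn0' : (0 : ℝ) < n := by exact_mod_cast hn0
    rw [lt_div_iff₀ hn0']
    nlinarith
  · intro a ha
    -- A fixed block length whose mean rate is already below `a`; the Birkhoff sums of that block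
    -- dominate the process up to a bounded error.
    obtain ⟨m, hm⟩ := exists_lt_of_ciInf_lt ha
    set p := m + 1 with hp
    have hp0 : (0 : ℝ) < (p : ℝ) := by positivity
    rw [div_lt_iff₀ hp0] at hm
    obtain ⟨k, hk⟩ := exists_nat_one_div_lt (half_pos (sub_pos.2 hm))
    set δ := (a * p - ∫ x, f p x ∂μ) / 2 with hδ
    have hlarge : ∀ᶠ n : ℕ in atTop, 2 * C * p ^ 2 + |a| * p ^ 2 < δ * n :=
      (tendsto_natCast_atTop_atTop.const_mul_atTop (half_pos (sub_pos.2 hm))).eventually_gt_atTop _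
    have hev : ∀ᶠ n : ℕ in atTop, f (n + p) x / ((n + p : ℕ) : ℝ) < a := by
      filter_upwards [hx2 p k, hlarge] with n hn1 hn2
      have h1 := subadditive_le_birkhoff hsub p n x hx3
      have hn0 : (0 : ℝ) ≤ n := by positivity
      have h3 : (0 : ℝ) < ((n + p : ℕ) : ℝ) := by push_cast; positivity
      rw [div_lt_iff₀ h3]
      have h4 : (1 / ((k : ℝ) + 1)) * n ≤ δ * n := by gcongr
      have h5 := neg_abs_le a
      have h6 : p * f (n + p) x < p * (a * ((n + p : ℕ) : ℝ)) := by
        push_cast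
        have : (∫ x, f p x ∂μ) * n = a * p * n - 2 * (δ * n) := by rw [hδ]; ring
        nlinarith [sq_nonneg (p : ℝ)]
      exact lt_of_mul_lt_mul_left h6 hp0.le
    rw [← map_add_atTop_eq_nat p]
    exact eventually_map.2 hev

end Kingman

/-! ### Deterministic estimates for minimal actions. -/

section Walks

variable {b f : ℤ → ℝ} {n : ℕ} {k : ℤ}

lemma abs_le_of_mem_lazyWalks {γ : Fin (n + 1) → ℤ} (hγ : γ ∈ lazyWalks n k)
    (i : Fin (n + 1)) : |γ i| ≤ (i : ℤ) := by
  induction i using Fin.induction with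
  | zero => simp [hγ.1]
  | succ i ih =>
    have h := hγ.2.2 i
    rw [abs_le] at h ih ⊢
    simp only [Fin.val_castSucc, Fin.val_succ] at ih ⊢
    push_cast
    constructor <;> linarith [h.1, h.2, ih.1, ih.2]

lemma minAction_zero : minAction b f 0 0 = 0 := by
  obtain ⟨γ, -, h⟩ := (isLeast_minAction b f (n := 0) (k := 0) (by simp)).1
  rw [← h]
  simp [action]

lemma minAction_succ_le {j : ℤ} (hj : |j| ≤ n) (hkj : |k - j| ≤ 1) :
    minAction b f (n + 1) k ≤ minAction b f n j + f k * b (n + 1) := by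
  have hk : |k| ≤ (n + 1 : ℕ) := by
    rw [abs_le] at *; push_cast; omega
  obtain ⟨γ, hγ, h⟩ := (isLeast_minAction b f hj).1
  rw [← h]
  refine (isLeast_minAction b f hk).2
    ⟨Fin.snoc (α := fun _ => ℤ) γ k, ⟨?_, ?_, ?_⟩, ?_⟩
  · have : (0 : Fin (n + 1 + 1)) = Fin.castSucc 0 := rfl
    rw [this, Fin.snoc_castSucc, hγ.1]
  · rw [Fin.snoc_last]
  · intro i
    induction i using Fin.lastCases with
    | last =>
      rw [Fin.succ_last, Fin.snoc_last, Fin.snoc_castSucc, hγ.2.1]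
      exact hkj
    | cast i =>
      rw [Fin.succ_castSucc, Fin.snoc_castSucc, Fin.snoc_castSucc]
      exact hγ.2.2 i
  · simp only [action]
    rw [Fin.sum_univ_castSucc]
    simp only [Fin.succ_castSucc, Fin.snoc_castSucc, Fin.succ_last, Fin.snoc_last,
      Fin.val_castSucc, Fin.val_last]

/-- The last step of an optimal walk. Together with `minAction_succ_le` this is the dynamic
programming recursion, which replaces paths by induction on `n` in most of the estimates below. -/
lemma exists_minAction_succ (b f : ℤ → ℝ) (hk : |k| ≤ (n + 1 : ℕ)) :
    ∃ j : ℤ, |j| ≤ n ∧ |k - j| ≤ 1 ∧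
      minAction b f (n + 1) k = minAction b f n j + f k * b (n + 1) := by
  obtain ⟨γ, hγ, h⟩ := (isLeast_minAction b f hk).1
  have h1 := hγ.2.2 (Fin.last n)
  rw [Fin.succ_last, hγ.2.1] at h1
  have h2 := abs_le_of_mem_lazyWalks hγ (Fin.last n).castSucc
  simp only [Fin.val_castSucc, Fin.val_last] at h2
  refine ⟨γ (Fin.last n).castSucc, h2, h1, le_antisymm (minAction_succ_le h2 h1) ?_⟩
  rw [← h]
  have h3 : action b f γ = action b f (fun i : Fin (n + 1) => γ i.castSucc) +
      f k * b (n + 1) := by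
    simp only [action]
    rw [Fin.sum_univ_castSucc]
    simp [hγ.2.1]
  rw [h3]
  gcongr
  refine (isLeast_minAction b f h2).2 ⟨_, ⟨?_, rfl, fun i => ?_⟩, rfl⟩
  · simp [hγ.1]
  · simpa using hγ.2.2 i.castSucc

/-- Concatenation: the second walk sees the environment shifted to the endpoint of the first. -/
lemma minAction_add_le (m : ℕ) {j : ℤ} (hk : |k| ≤ n) (hj : |j| ≤ m) :
    minAction b f (n + m) (k + j) ≤ minAction b f n k +
      minAction (fun i => b (i + n)) (fun x => f (x + k)) m j := by
  induction m generalizing j with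
  | zero =>
    obtain rfl : j = 0 := by simpa using hj
    simp [minAction_zero]
  | succ m ih =>
    obtain ⟨j', h1, h2, h3⟩ := exists_minAction_succ (fun i => b (i + n)) (fun x => f (x + k)) hj
    rw [h3]
    have h4 : |k + j'| ≤ (n + m : ℕ) := by
      rw [abs_le] at *; push_cast; omega
    have h5 := minAction_succ_le (b := b) (f := f) h4 (k := k + j) (by
      rw [abs_le] at *; omega)
    have h6 := ih h1
    push_cast at h5
    rw [show (n + m + 1 : ℤ) = m + 1 + n by ring, add_comm k j] at h5
    rw [add_comm k j, ← add_assoc n m 1]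
    linarith

lemma abs_minAction_le {c : ℝ} (hf : ∀ x, |f x| ≤ c) (hb : ∀ i, |b i| ≤ 1) (hk : |k| ≤ n) :
    |minAction b f n k| ≤ c * n := by
  induction n generalizing k with
  | zero =>
    obtain rfl : k = 0 := by simpa using hk
    simp [minAction_zero]
  | succ n ih =>
    obtain ⟨j, h1, h2, h3⟩ := exists_minAction_succ b f hk
    rw [h3]
    have h4 : |f k * b (n + 1)| ≤ c * 1 := by
      rw [abs_mul]
      exact mul_le_mul (hf _) (hb _) (abs_nonneg _) ((abs_nonneg _).trans (hf 0))
    have := abs_add_le (minAction b f n j) (f k * b (n + 1))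
    have := ih h1
    push_cast
    linarith

/-- A walk can be prolonged to any site that it can reach, at a cost of at most `c` a step. -/
lemma minAction_extend {c : ℝ} (hf : ∀ x, |f x| ≤ c) (hb : ∀ i, |b i| ≤ 1) {m : ℕ} {l : ℤ}
    (hk : |k| ≤ n) (hnm : n ≤ m) (hl : |l - k| ≤ (m - n : ℤ)) :
    minAction b f m l ≤ minAction b f n k + c * (m - n) := by
  obtain ⟨p, rfl⟩ := Nat.exists_eq_add_of_le hnm
  have hj : |l - k| ≤ (p : ℤ) := by push_cast at hl; linarith
  have h1 := minAction_add_le (b := b) (f := f) p hk hj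
  have h2 := le_of_abs_le (abs_minAction_le (f := fun x => f (x + k)) (b := fun i => b (i + n))
    (c := c) (fun x => hf _) (fun i => hb _) hj)
  rw [add_sub_cancel] at h1
  push_cast
  linarith

lemma minAction_reflect_le (b f : ℤ → ℝ) (hk : |k| ≤ n) :
    minAction b (fun x => f (-x)) n (-k) ≤ minAction b f n k := by
  induction n generalizing k with
  | zero =>
    obtain rfl : k = 0 := by simpa using hk
    simp [minAction_zero]
  | succ n ih =>
    obtain ⟨j, h1, h2, h3⟩ := exists_minAction_succ b f hk
    rw [h3]
    have h4 := minAction_succ_le (b := b) (f := fun x => f (-x)) (n := n) (j := -j) (k := -k)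
      (by rwa [abs_neg]) (by rw [abs_le] at *; omega)
    simp only [neg_neg] at h4
    linarith [ih h1]

lemma minAction_reflect (b f : ℤ → ℝ) (hk : |k| ≤ n) :
    minAction b (fun x => f (-x)) n (-k) = minAction b f n k := by
  refine le_antisymm (minAction_reflect_le b f hk) ?_
  have := minAction_reflect_le b (fun x => f (-x)) (k := -k) (n := n) (by rwa [abs_neg])
  simpa using this

/-- The walk visits every site between its endpoints, and `f x` keeps it off the minimal
conceivable action `-c` by `c - |f x|` at each visit. -/
lemma le_minAction_of_visits {c : ℝ} (hf : ∀ x, |f x| ≤ c) (hb : ∀ i, |b i| ≤ 1)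
    (hk : |k| ≤ n) :
    -c * n + ∑ x ∈ Finset.Ioc 0 k, (c - |f x|) ≤ minAction b f n k := by
  induction n generalizing k with
  | zero =>
    obtain rfl : k = 0 := by simpa using hk
    simp [minAction_zero]
  | succ n ih =>
    obtain ⟨j, h1, h2, h3⟩ := exists_minAction_succ b f hk
    rw [h3]
    have h4 := ih h1
    have h5 : -|f k| ≤ f k * b (n + 1) := by
      have : |f k * b (n + 1)| ≤ |f k| * 1 := by
        rw [abs_mul]; exact mul_le_mul_of_nonneg_left (hb _) (abs_nonneg _)
      linarith [neg_abs_le (f k * b (n + 1))]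
    have h6 : ∑ x ∈ Finset.Ioc 0 k, (c - |f x|) ≤
        ∑ x ∈ Finset.Ioc 0 j, (c - |f x|) + (c - |f k|) := by
      have hnn : ∀ x, 0 ≤ c - |f x| := fun x => sub_nonneg.2 (hf x)
      -- A step changes the position by at most one, so the only site of `(0, k]` that can be new is
      -- `k` itself, which pays its gap in this step.
      have hsub : Finset.Ioc 0 k ⊆ insert k (Finset.Ioc 0 j) := by
        intro x hx
        rw [Finset.mem_insert, Finset.mem_Ioc]
        rw [Finset.mem_Ioc] at hx
        rw [abs_le] at h2
        omega
      refine (Finset.sum_le_sum_of_subset_of_nonneg hsub fun x _ _ => hnn x).trans ?_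
      by_cases hkj : k ∈ Finset.Ioc 0 j
      · rw [Finset.insert_eq_of_mem hkj]
        linarith [hnn k]
      · rw [Finset.sum_insert hkj, add_comm]
    push_cast
    linarith

lemma minAction_diagonal (b f : ℤ → ℝ) (n : ℕ) :
    minAction b f n n = ∑ i ∈ Finset.range n, f (i + 1) * b (i + 1) := by
  induction n with
  | zero => simpa using minAction_zero
  | succ n ih =>
    obtain ⟨j, h1, h2, h3⟩ := exists_minAction_succ b f (n := n) (k := (n + 1 : ℕ)) (by
      rw [abs_of_nonneg (by positivity)])
    obtain rfl : j = n := by rw [abs_le] at *; push_cast at h2; omega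
    rw [h3, ih, Finset.sum_range_succ]
    push_cast
    rfl

/-- The competitor that runs along the diagonal and waits at its end. It is to be compared with the
one of `minAction_pause_first_le`, which waits at `0` first. -/
lemma minAction_pause_last_le (b f : ℤ → ℝ) (n : ℕ) :
    minAction b f (n + 1) n ≤
      ∑ i ∈ Finset.range n, f (i + 1) * b (i + 1) + f n * b (n + 1) := by
  rw [← minAction_diagonal]
  exact minAction_succ_le (by simp) (by simp)

lemma minAction_pause_first_le (b f : ℤ → ℝ) (n : ℕ) :
    minAction b f (n + 1) n ≤ ∑ i ∈ Finset.range (n + 1), f i * b (i + 1) := by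
  induction n with
  | zero =>
    have := minAction_succ_le (b := b) (f := f) (n := 0) (j := 0) (k := 0) (by simp) (by simp)
    simpa [minAction_zero] using this
  | succ n ih =>
    have := minAction_succ_le (b := b) (f := f) (n := n + 1) (j := n) (k := (n + 1 : ℕ))
      (by simp) (by simp)
    rw [Finset.sum_range_succ]
    push_cast at this ⊢
    linarith

/-- Two neighbouring sites with potential near `c` and `-c` allow an action near `-c` a step. -/
lemma minAction_dwell_le {c d : ℝ} (hb : ∀ i, b i = 1 ∨ b i = -1) (hf : ∀ x, |f x| ≤ c)
    (h0 : d ≤ f 0) (h1 : f 1 ≤ -d) (n : ℕ) :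
    minAction b f (n + 1) 0 ≤ -d * n + c := by
  -- The walk stands at `1` whenever the sign is `1` and at `0` whenever it is `-1`. One more step,
  -- of cost at most `c`, brings it back to `0`.
  have key : ∀ n : ℕ, ∃ j : ℤ, (j = 0 ∨ j = 1) ∧ |j| ≤ n ∧ minAction b f n j ≤ -d * n := by
    intro n
    induction n with
    | zero => exact ⟨0, Or.inl rfl, by simp, by simp [minAction_zero]⟩
    | succ n ih =>
      obtain ⟨j, hj, hjn, h⟩ := ih
      rcases hb (n + 1) with hb1 | hb1
      · refine ⟨1, Or.inr rfl, by simp, ?_⟩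
        have := minAction_succ_le (b := b) (f := f) hjn (k := 1) (by
          rcases hj with rfl | rfl <;> simp)
        rw [hb1] at this
        push_cast
        linarith
      · refine ⟨0, Or.inl rfl, by simp; positivity, ?_⟩
        have := minAction_succ_le (b := b) (f := f) hjn (k := 0) (by
          rcases hj with rfl | rfl <;> simp)
        rw [hb1] at this
        push_cast
        linarith
  obtain ⟨j, hj, hjn, h⟩ := key n
  have h2 := minAction_succ_le (b := b) (f := f) hjn (k := 0) (by
    rcases hj with rfl | rfl <;> simp)
  have h3 := abs_le.1 (hf 0)
  rcases hb (n + 1) with hb1 | hb1 <;> rw [hb1] at h2 <;> linarith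

end Walks

/-! ### The law of the environment as a product measure. -/

section Law

/-- The law of a fair sign. -/
noncomputable def signLaw : Measure ℝ :=
  (1 / 2 : ENNReal) • Measure.dirac 1 + (1 / 2 : ENNReal) • Measure.dirac (-1)

instance : IsProbabilityMeasure signLaw :=
  ⟨by simp [signLaw, ENNReal.inv_two_add_inv_two]⟩

lemma ae_signLaw : ∀ᵐ y ∂signLaw, y = 1 ∨ y = -1 := by
  rw [signLaw, ae_add_measure_iff]
  have hm : MeasurableSet {y : ℝ | y = 1 ∨ y = -1} :=
    (measurableSet_singleton 1).union (measurableSet_singleton (-1))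
  constructor <;> refine Measure.ae_smul_measure ?_ _ <;> rw [ae_dirac_iff hm] <;> simp

lemma map_neg_signLaw : signLaw.map (fun y => -y) = signLaw := by
  rw [signLaw, Measure.map_add _ _ measurable_neg, Measure.map_smul, Measure.map_smul,
    Measure.map_dirac' measurable_neg, Measure.map_dirac' measurable_neg, neg_neg, add_comm]

lemma eq_signLaw {β : Measure ℝ} [IsProbabilityMeasure β] (h1 : β {1} = 1 / 2)
    (h2 : β {-1} = 1 / 2) : β = signLaw := by
  have hne : ({1} : Set ℝ) ∩ {-1} = ∅ := by
    ext x; simp; intro h; rw [h]; norm_num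
  have hU : β ({1} ∪ {-1})ᶜ = 0 := by
    rw [prob_compl_eq_zero_iff ((measurableSet_singleton _).union (measurableSet_singleton _)),
      measure_union (disjoint_iff_inter_eq_empty.2 hne) (measurableSet_singleton _), h1, h2,
      ENNReal.add_halves]
  ext s hs
  have e : β s = β (s ∩ {1}) + β (s ∩ {-1}) := by
    rw [← measure_union _ (hs.inter (measurableSet_singleton _)), ← inter_union_distrib_left,
      measure_inter_conull hU]
    exact disjoint_iff_inter_eq_empty.2 (by
      rw [← inter_inter_distrib_left, hne, inter_empty])
  have e' : ∀ a : ℝ, β {a} = 1 / 2 → β (s ∩ {a}) = (1 / 2 : ENNReal) * s.indicator 1 a := by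
    intro a ha
    by_cases h : a ∈ s
    · rw [inter_eq_right.2 (singleton_subset_iff.2 h), ha]
      simp [h]
    · rw [(disjoint_singleton_right.2 h).inter_eq]
      simp [h]
  rw [e, e' 1 h1, e' (-1) h2]
  simp [signLaw, Measure.dirac_apply' _ hs]

/-- What matters of the law of the spatial potential: it lives on `[-c, c]` and charges the
open interval and all neighbourhoods of both endpoints. -/
structure IsSiteLaw (c : ℝ) (ν : Measure ℝ) : Prop where
  ae_abs_le : ∀ᵐ y ∂ν, |y| ≤ c
  interior_pos : 0 < ν (Ioo (-c) c)
  right_pos : ∀ a < c, 0 < ν (Ioi a)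
  left_pos : ∀ a < c, 0 < ν (Iio (-a))

/-- The law of the pair of families, with the time potential on the left copy of `ℤ` and the
spatial potential on the right one. -/
noncomputable def envLaw (ν : Measure ℝ) : Measure (ℤ ⊕ ℤ → ℝ) :=
  Measure.infinitePi (Sum.elim (fun _ => signLaw) (fun _ => ν))

instance instProbSum (ν : Measure ℝ) [IsProbabilityMeasure ν] (i : ℤ ⊕ ℤ) :
    IsProbabilityMeasure
      (Sum.elim (fun _ : ℤ => signLaw) (fun _ : ℤ => ν) i : Measure ℝ) := by
  cases i <;> (simp only [Sum.elim_inl, Sum.elim_inr]; infer_instance)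

instance (ν : Measure ℝ) [IsProbabilityMeasure ν] : IsProbabilityMeasure (envLaw ν) := by
  unfold envLaw; infer_instance

variable {Ω : Type*} [MeasurableSpace Ω] {P : Measure Ω}
  {c κ q : ℝ} {ρ : ℝ → ℝ} {B F : ℤ → Ω → ℝ}

lemma IsSpatialDensity.measurable (hρ : IsSpatialDensity c κ q ρ) : Measurable ρ := by
  classical
  have h : ρ = (Ioo (-c) c).piecewise ρ (fun _ => 0) := by
    ext x
    by_cases hx : x ∈ Ioo (-c) c
    · rw [piecewise_eq_of_mem _ _ _ hx]
    · rw [piecewise_eq_of_notMem _ _ _ hx, hρ.eq_zero x hx]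
  rw [h]
  exact hρ.continuousOn.measurable_piecewise continuousOn_const measurableSet_Ioo

lemma IsSpatialDensity.isSiteLaw (hc : 0 < c) (hρ : IsSpatialDensity c κ q ρ) :
    IsSiteLaw c (volume.withDensity fun y => ENNReal.ofReal (ρ y)) := by
  have hm : Measurable fun y => ENNReal.ofReal (ρ y) := hρ.measurable.ennreal_ofReal
  have hpos : ∀ l r : ℝ, -c ≤ l → r ≤ c → l < r →
      0 < (volume.withDensity fun y => ENNReal.ofReal (ρ y)) (Ioo l r) := by
    intro l r hl hr hlr
    rw [pos_iff_ne_zero, Ne, withDensity_apply_eq_zero hm]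
    have : {x | ENNReal.ofReal (ρ x) ≠ 0} ∩ Ioo l r = Ioo l r := by
      refine inter_eq_right.2 fun x hx => ?_
      have := hρ.pos x ⟨hl.trans_lt hx.1, hx.2.trans_le hr⟩
      simpa using this
    rw [this]
    simp [hlr]
  refine ⟨?_, hpos _ _ le_rfl le_rfl (by linarith), fun a ha => ?_, fun a ha => ?_⟩
  · rw [ae_iff, withDensity_apply_eq_zero hm]
    refine measure_mono_null (t := ∅) ?_ measure_empty
    rintro x ⟨h1, h2⟩
    refine h1 ?_
    rw [hρ.eq_zero x, ENNReal.ofReal_zero]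
    intro hx
    exact h2 (abs_le.2 ⟨hx.1.le, hx.2.le⟩)
  · exact (hpos (max a (-c)) c (le_max_right _ _) le_rfl (max_lt ha (by linarith))).trans_le
      (measure_mono fun x hx => (le_max_left _ _).trans_lt hx.1)
  · exact (hpos (-c) (min (-a) c) le_rfl (min_le_right _ _)
      (lt_min (by linarith) (by linarith))).trans_le
      (measure_mono fun x hx => hx.2.trans_le (min_le_left _ _))

/-- The potentials as one random configuration. -/
def envMap (B F : ℤ → Ω → ℝ) (ω : Ω) : ℤ ⊕ ℤ → ℝ := Sum.elim (fun i => B i ω) (fun x => F x ω)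

lemma IsEnvironment.measurable_envMap (h : IsEnvironment P ρ B F) : Measurable (envMap B F) := by
  refine measurable_pi_iff.2 fun i => ?_
  cases i with
  | inl i => exact h.measurable_B i
  | inr i => exact h.measurable_F i

lemma IsEnvironment.isProbabilityMeasure [IsProbabilityMeasure P] (h : IsEnvironment P ρ B F) :
    IsProbabilityMeasure (volume.withDensity fun y => ENNReal.ofReal (ρ y)) := by
  rw [← h.law_F 0]
  exact Measure.isProbabilityMeasure_map (h.measurable_F 0).aemeasurable

lemma IsEnvironment.map_B [IsProbabilityMeasure P] (h : IsEnvironment P ρ B F) (i : ℤ) : P.map (B i) = signLaw := by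
  have := Measure.isProbabilityMeasure_map (μ := P) (h.measurable_B i).aemeasurable
  refine eq_signLaw ?_ ?_
  · rw [Measure.map_apply (h.measurable_B i) (measurableSet_singleton _)]
    exact h.prob_B_one i
  · rw [Measure.map_apply (h.measurable_B i) (measurableSet_singleton _)]
    exact h.prob_B_neg_one i

/-- This permits work on the canonical product space, where shifts, reflections and sign changes are
measure-preserving maps, and the transfer of almost sure statements back to the given space. -/
lemma IsEnvironment.map_envMap [IsProbabilityMeasure P] (h : IsEnvironment P ρ B F) :
    P.map (envMap B F) = envLaw (volume.withDensity fun y => ENNReal.ofReal (ρ y)) := by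
  have := h.isProbabilityMeasure
  refine Measure.eq_infinitePi _ fun s t ht => ?_
  rw [Measure.map_apply h.measurable_envMap (.pi s.countable_toSet fun _ _ => ht _)]
  have hset : envMap B F ⁻¹' (s : Set (ℤ ⊕ ℤ)).pi t =
      ((fun ω i => B i ω) ⁻¹' (s.toLeft : Set ℤ).pi fun i => t (.inl i)) ∩
      ((fun ω x => F x ω) ⁻¹' (s.toRight : Set ℤ).pi fun i => t (.inr i)) := by
    ext ω
    simp [envMap, Set.mem_pi]
  rw [hset, h.indep.measure_inter_preimage_eq_mul _ _
    (.pi (Finset.countable_toSet _) fun _ _ => ht _)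
    (.pi (Finset.countable_toSet _) fun _ _ => ht _)]
  have hB : P ((fun ω i => B i ω) ⁻¹' (s.toLeft : Set ℤ).pi fun i => t (.inl i)) =
      ∏ i ∈ s.toLeft, signLaw (t (.inl i)) := by
    rw [← Measure.map_apply (measurable_pi_iff.2 h.measurable_B)
      (.pi (Finset.countable_toSet _) fun _ _ => ht _),
      h.iIndep_B.map_fun_eq_infinitePi_map h.measurable_B]
    simp only [h.map_B]
    exact Measure.infinitePi_pi _ fun _ _ => ht _
  have hF : P ((fun ω x => F x ω) ⁻¹' (s.toRight : Set ℤ).pi fun i => t (.inr i)) =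
      ∏ i ∈ s.toRight, (volume.withDensity fun y => ENNReal.ofReal (ρ y)) (t (.inr i)) := by
    rw [← Measure.map_apply (measurable_pi_iff.2 h.measurable_F)
      (.pi (Finset.countable_toSet _) fun _ _ => ht _),
      h.iIndep_F.map_fun_eq_infinitePi_map h.measurable_F]
    simp only [h.law_F]
    exact Measure.infinitePi_pi _ fun _ _ => ht _
  rw [hB, hF]
  conv_rhs => rw [← Finset.toLeft_disjSum_toRight (u := s), Finset.prod_disjSum]
  rfl

end Law

/-! ### Symmetries of the canonical environment and limits along rational slopes. -/

section Config

variable {c : ℝ} {ν : Measure ℝ}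

lemma integral_comp_of_measurePreserving {T : (ℤ ⊕ ℤ → ℝ) → ℤ ⊕ ℤ → ℝ}
    (hT : MeasurePreserving T (envLaw ν) (envLaw ν)) {g : (ℤ ⊕ ℤ → ℝ) → ℝ} (hg : Measurable g) :
    ∫ ω, g (T ω) ∂envLaw ν = ∫ ω, g ω ∂envLaw ν := by
  rw [← integral_map hT.measurable.aemeasurable hg.aestronglyMeasurable, hT.map_eq]

variable [IsProbabilityMeasure ν]

/-- The minimal action in the configuration `ω`. -/
noncomputable def confAction (n : ℕ) (k : ℤ) (ω : ℤ ⊕ ℤ → ℝ) : ℝ :=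
  minAction (fun i => ω (.inl i)) (fun x => ω (.inr x)) n k

lemma measurable_confAction (n : ℕ) (k : ℤ) : Measurable (confAction n k) := by
  have : confAction n k = fun ω => ⨅ γ : lazyWalks n k,
      action (fun i => ω (.inl i)) (fun x => ω (.inr x)) (γ : Fin (n + 1) → ℤ) := by
    ext ω
    rw [confAction, minAction, sInf_image']
  rw [this]
  have := (lazyWalks_finite n k).countable.to_subtype
  refine Measurable.iInf fun γ => ?_
  unfold action
  fun_prop

/-- Translation by `s` in time and by `x` in space. -/
def shiftPerm (s x : ℤ) : Equiv.Perm (ℤ ⊕ ℤ) := (Equiv.addRight s).sumCongr (Equiv.addRight x)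

lemma shiftPerm_pow (s x : ℤ) (n : ℕ) : shiftPerm s x ^ n = shiftPerm (n * s) (n * x) := by
  induction n with
  | zero => ext i; cases i <;> simp [shiftPerm]
  | succ n ih =>
    rw [pow_succ, ih]
    ext i
    cases i <;> simp [shiftPerm] <;> ring

lemma measurePreserving_shift (s x : ℤ) :
    MeasurePreserving (fun ω : ℤ ⊕ ℤ → ℝ => ω ∘ shiftPerm s x) (envLaw ν) (envLaw ν) :=
  measurePreserving_reindex _ _ fun i => by cases i <;> rfl

/-- Both components have to be nonzero: with `x = 0` the spatial potential would stay fixed. This is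
why slope `0` is excluded from the ergodic theorem and recovered by approximation. -/
lemma ergodic_shift {s x : ℤ} (hs : s ≠ 0) (hx : x ≠ 0) :
    Ergodic (fun ω : ℤ ⊕ ℤ → ℝ => ω ∘ shiftPerm s x) (envLaw ν) := by
  refine ergodic_reindex _ _ (fun i => by cases i <;> rfl) fun t => ?_
  obtain ⟨M, hM⟩ : ∃ M : ℕ, ∀ i ∈ t, i.elim Int.natAbs Int.natAbs ≤ M :=
    ⟨t.sup fun i => i.elim Int.natAbs Int.natAbs,
      fun i hi => Finset.le_sup (f := fun i => i.elim Int.natAbs Int.natAbs) hi⟩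
  -- Coordinates of modulus at most `M` leave that range after a displacement of at least `2 * M +
  -- 1`.
  refine ⟨2 * M + 1, fun i hi hi' => ?_⟩
  rw [shiftPerm_pow] at hi'
  have h1 := hM _ hi
  have h2 := hM _ hi'
  have key : ∀ a z : ℤ, z ≠ 0 → a.natAbs ≤ M → ¬ (a + ((2 * M + 1 : ℕ) : ℤ) * z).natAbs ≤ M := by
    intro a z hz ha hcon
    have h3 : (((2 * M + 1 : ℕ) : ℤ) * z).natAbs ≤ M + M := by
      have : ((2 * M + 1 : ℕ) : ℤ) * z = (a + ((2 * M + 1 : ℕ) : ℤ) * z) - a := by ring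
      rw [this]
      exact (Int.natAbs_sub_le _ _).trans (add_le_add hcon ha)
    rw [Int.natAbs_mul, Int.natAbs_natCast] at h3
    have : 1 ≤ z.natAbs := Nat.one_le_iff_ne_zero.2 (Int.natAbs_ne_zero.2 hz)
    nlinarith
  cases i with
  | inl i => exact key i s hs h1 (by simpa [shiftPerm] using h2)
  | inr i => exact key i x hx h1 (by simpa [shiftPerm] using h2)

/-- Change of sign of one time potential. -/
noncomputable def flip (i : ℤ) (ω : ℤ ⊕ ℤ → ℝ) : ℤ ⊕ ℤ → ℝ :=
  fun j => if j = .inl i then -ω j else ω j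

lemma measurePreserving_flip (i : ℤ) : MeasurePreserving (flip i) (envLaw ν) (envLaw ν) := by
  classical
  let g : ℤ ⊕ ℤ → ℝ → ℝ := fun j y => if j = .inl i then -y else y
  have hg : ∀ j, Measurable (g j) := fun j => by
    by_cases h : j = .inl i
    · simp only [g, h, if_true]; exact measurable_neg
    · simp only [g, h, if_false]; exact measurable_id
  refine ⟨measurable_pi_iff.2 fun j => (hg j).comp (measurable_pi_apply j), ?_⟩
  refine (Measure.infinitePi_map_pi (μ := Sum.elim (fun _ => signLaw) (fun _ => ν)) hg).trans ?_
  unfold envLaw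
  congr 1
  ext1 j
  by_cases h : j = .inl i
  · subst h
    simpa [g] using map_neg_signLaw
  · simp [g, h]

/-- Reflection of the spatial potential. -/
def reflectPerm : Equiv.Perm (ℤ ⊕ ℤ) := (Equiv.refl ℤ).sumCongr (Equiv.neg ℤ)

lemma measurePreserving_reflect :
    MeasurePreserving (fun ω : ℤ ⊕ ℤ → ℝ => ω ∘ reflectPerm) (envLaw ν) (envLaw ν) :=
  measurePreserving_reindex _ _ fun i => by cases i <;> rfl

lemma measurePreserving_eval (i : ℤ ⊕ ℤ) :
    MeasurePreserving (fun ω : ℤ ⊕ ℤ → ℝ => ω i) (envLaw ν)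
      (Sum.elim (fun _ => signLaw) (fun _ => ν) i) :=
  measurePreserving_eval_infinitePi _ i

/-- The configurations with signs in time and potentials bounded by `c` in space. -/
def goodConf (c : ℝ) : Set (ℤ ⊕ ℤ → ℝ) :=
  {ω | (∀ i, ω (.inl i) = 1 ∨ ω (.inl i) = -1) ∧ ∀ x, |ω (.inr x)| ≤ c}

lemma ae_goodConf (hν : IsSiteLaw c ν) : ∀ᵐ ω ∂envLaw ν, ω ∈ goodConf c := by
  have h1 : ∀ᵐ ω ∂envLaw ν, ∀ i : ℤ, ω (.inl i) = 1 ∨ ω (.inl i) = -1 :=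
    ae_all_iff.2 fun i =>
      (measurePreserving_eval (ν := ν) (.inl i)).quasiMeasurePreserving.ae ae_signLaw
  have h2 : ∀ᵐ ω ∂envLaw ν, ∀ x : ℤ, |ω (.inr x)| ≤ c :=
    ae_all_iff.2 fun i =>
      (measurePreserving_eval (ν := ν) (.inr i)).quasiMeasurePreserving.ae hν.ae_abs_le
  filter_upwards [h1, h2] with ω h1 h2 using ⟨h1, h2⟩

lemma abs_sign_le {ω : ℤ ⊕ ℤ → ℝ} (hω : ω ∈ goodConf c) (i : ℤ) : |ω (.inl i)| ≤ 1 := by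
  rcases hω.1 i with h | h <;> simp [h]

lemma abs_confAction_le {ω : ℤ ⊕ ℤ → ℝ} (hω : ω ∈ goodConf c) {n : ℕ} {k : ℤ} (hk : |k| ≤ n) :
    |confAction n k ω| ≤ c * n :=
  abs_minAction_le hω.2 (abs_sign_le hω) hk

lemma integrable_of_goodConf_bound (hν : IsSiteLaw c ν) {g : (ℤ ⊕ ℤ → ℝ) → ℝ}
    (hg : Measurable g) (K : ℝ) (h : ∀ ω ∈ goodConf c, |g ω| ≤ K) : Integrable g (envLaw ν) :=
  Integrable.of_bound hg.aestronglyMeasurable K (by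
    filter_upwards [ae_goodConf hν] with ω hω using h ω hω)

lemma integrable_confAction (hν : IsSiteLaw c ν) {n : ℕ} {k : ℤ} (hk : |k| ≤ n) :
    Integrable (confAction n k) (envLaw ν) :=
  integrable_of_goodConf_bound hν (measurable_confAction n k) (c * n)
    fun _ hω => abs_confAction_le hω hk

lemma confAction_add_le {n m : ℕ} {k j : ℤ} (hk : |k| ≤ n) (hj : |j| ≤ m) (ω : ℤ ⊕ ℤ → ℝ) :
    confAction (n + m) (k + j) ω ≤ confAction n k ω + confAction m j (ω ∘ shiftPerm n k) :=
  minAction_add_le m hk hj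

lemma confAction_reflect {n : ℕ} {k : ℤ} (hk : |k| ≤ n) (ω : ℤ ⊕ ℤ → ℝ) :
    confAction n (-k) (ω ∘ reflectPerm) = confAction n k ω := by
  have := minAction_reflect (fun i => ω (.inl i)) (fun x => ω (.inr x)) hk
  simpa [confAction, reflectPerm] using this

/-- The expected minimal action. -/
noncomputable def meanAction (ν : Measure ℝ) (n : ℕ) (k : ℤ) : ℝ :=
  ∫ ω, confAction n k ω ∂envLaw ν

lemma meanAction_add_le (hν : IsSiteLaw c ν) {n m : ℕ} {k j : ℤ} (hk : |k| ≤ n) (hj : |j| ≤ m) :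
    meanAction ν (n + m) (k + j) ≤ meanAction ν n k + meanAction ν m j := by
  have hkj : |k + j| ≤ (n + m : ℕ) := by
    push_cast; exact (abs_add_le _ _).trans (add_le_add hk hj)
  have hT := measurePreserving_shift (ν := ν) n k
  have hi := hT.integrable_comp_of_integrable (integrable_confAction hν hj)
  have h1 := integral_mono (integrable_confAction hν hkj)
    ((integrable_confAction hν hk).add hi) (confAction_add_le hk hj)
  have h2 : ∫ ω, (confAction n k + confAction m j ∘ fun ω => ω ∘ shiftPerm n k) ω ∂envLaw ν =
      meanAction ν n k + meanAction ν m j := by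
    rw [integral_add' (integrable_confAction hν hk) hi]
    congr 1
    exact integral_comp_of_measurePreserving hT (measurable_confAction m j)
  exact h1.trans_eq h2

lemma meanAction_neg {n : ℕ} {k : ℤ} (hk : |k| ≤ n) :
    meanAction ν n (-k) = meanAction ν n k := by
  unfold meanAction
  rw [← integral_comp_of_measurePreserving measurePreserving_reflect (measurable_confAction n (-k))]
  simp only [confAction_reflect hk]

lemma meanAction_mul_le (hν : IsSiteLaw c ν) {n : ℕ} {k : ℤ} (hk : |k| ≤ n) (m : ℕ) :
    meanAction ν (m * n) (m * k) ≤ m * meanAction ν n k := by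
  induction m with
  | zero => simp [meanAction, confAction, minAction_zero]
  | succ m ih =>
    have h1 : |(m : ℤ) * k| ≤ (m * n : ℕ) := by
      rw [abs_mul, abs_of_nonneg (by positivity : (0 : ℤ) ≤ m)]
      push_cast
      gcongr
    have := meanAction_add_le hν h1 hk
    rw [add_mul, one_mul]
    push_cast
    rw [add_mul, one_mul, add_mul, one_mul]
    linarith

/-- The law of large numbers along a nonzero rational slope. -/
lemma exists_tendsto_rational (hν : IsSiteLaw c ν) (hc : 0 < c) {q : ℕ} {p : ℤ} (hq : q ≠ 0)
    (hp : p ≠ 0) (hpq : |p| ≤ q) :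
    ∃ l : ℝ, ∀ᵐ ω ∂envLaw ν,
      Tendsto (fun n : ℕ => confAction (n * q) (n * p) ω / n) atTop (𝓝 l) := by
  have hnp : ∀ n : ℕ, |(n : ℤ) * p| ≤ (n * q : ℕ) := fun n => by
    rw [abs_mul, abs_of_nonneg (by positivity : (0 : ℤ) ≤ n)]
    push_cast
    gcongr
  refine tendsto_of_subadditive (ergodic_shift (ν := ν) (s := q) (by exact_mod_cast hq) hp)
    (fun n => measurable_confAction _ _) (C := c * q) (by positivity) (fun n => ?_)
    (fun ω => by simp [confAction, minAction_zero]) (fun n m ω => ?_)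
  · filter_upwards [ae_goodConf hν] with ω hω
    refine (abs_confAction_le hω (hnp n)).trans_eq ?_
    push_cast
    ring
  · rw [iterate_reindex, shiftPerm_pow]
    have := confAction_add_le (hnp n) (hnp m) ω
    rw [add_mul]
    push_cast at this ⊢
    rw [add_mul]
    exact this

end Config

/-! ### Moment bounds: the gain from a pause, the loss at visited sites, and entropy. -/

section Moments

variable {c : ℝ} {ν : Measure ℝ}

@[simp] lemma flip_inl_self (i : ℤ) (ω : ℤ ⊕ ℤ → ℝ) : flip i ω (.inl i) = -ω (.inl i) := by
  simp [flip]

lemma flip_inl_of_ne {i j : ℤ} (h : j ≠ i) (ω : ℤ ⊕ ℤ → ℝ) : flip i ω (.inl j) = ω (.inl j) := by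
  simp [flip, h]

@[simp] lemma flip_inr (i x : ℤ) (ω : ℤ ⊕ ℤ → ℝ) : flip i ω (.inr x) = ω (.inr x) := by
  simp [flip]

/-- Signs later than time `n` do not enter. A flip at time `n + 1` thus acts on the new step alone,
which plays the part of conditioning on the past. -/
lemma confAction_flip {n : ℕ} {k : ℤ} {i : ℤ} (hi : (n : ℤ) < i) (ω : ℤ ⊕ ℤ → ℝ) :
    confAction n k (flip i ω) = confAction n k ω := by
  have : action (n := n) (fun j => flip i ω (.inl j)) (fun x => flip i ω (.inr x)) =
      action (n := n) (fun j => ω (.inl j)) (fun x => ω (.inr x)) := by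
    ext γ
    refine Finset.sum_congr rfl fun j _ => ?_
    have := j.2
    simp only [flip_inr]
    rw [flip_inl_of_ne (by omega)]
  rw [confAction, minAction, this]
  rfl

variable [IsProbabilityMeasure ν]

lemma integral_eq_zero_of_flip {g : (ℤ ⊕ ℤ → ℝ) → ℝ} (hg : Measurable g) (i : ℤ)
    (h : ∀ ω, g (flip i ω) = -g ω) : ∫ ω, g ω ∂envLaw ν = 0 := by
  have h1 := integral_comp_of_measurePreserving (measurePreserving_flip (ν := ν) i) hg
  simp only [h, integral_neg] at h1
  linarith

lemma integrable_pot_mul_sign (hν : IsSiteLaw c ν) (x i : ℤ) :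
    Integrable (fun ω => ω (.inr x) * ω (.inl i)) (envLaw ν) := by
  refine integrable_of_goodConf_bound hν (by fun_prop) (c * 1) fun ω hω => ?_
  rw [abs_mul]
  exact mul_le_mul (hω.2 _) (abs_sign_le hω i) (abs_nonneg _) ((abs_nonneg _).trans (hω.2 x))

lemma integral_pot_mul_sign (x i : ℤ) :
    ∫ ω, ω (.inr x) * ω (.inl i) ∂envLaw ν = 0 :=
  integral_eq_zero_of_flip (by fun_prop) i fun ω => by simp

lemma integral_sum_pot_mul_sign (hν : IsSiteLaw c ν) (x : ℕ → ℤ) (n : ℕ) :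
    ∫ ω, ∑ i ∈ Finset.range n, ω (.inr (x i)) * ω (.inl (i + 1)) ∂envLaw ν = 0 := by
  rw [integral_finsetSum _ fun i _ => integrable_pot_mul_sign hν _ _]
  simp [integral_pot_mul_sign]

lemma meanAction_diagonal (hν : IsSiteLaw c ν) (n : ℕ) : meanAction ν n n = 0 := by
  simp only [meanAction, confAction, minAction_diagonal]
  exact integral_sum_pot_mul_sign hν (fun i => i + 1) n

lemma measure_pair_pos (hν : IsSiteLaw c ν) {a : ℝ} (ha : a < c) :
    0 < envLaw ν {ω | a < ω (.inr 0) ∧ ω (.inr 1) < -a} := by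
  have h := Measure.infinitePi_map_eval_prod (P := Sum.elim (fun _ : ℤ => signLaw)
    (fun _ : ℤ => ν)) (i := .inr 0) (j := .inr 1) (by simp)
  have h2 : envLaw ν {ω | a < ω (.inr 0) ∧ ω (.inr 1) < -a} = ν (Ioi a) * ν (Iio (-a)) := by
    have h3 := congrArg (fun m : Measure (ℝ × ℝ) => m (Ioi a ×ˢ Iio (-a))) h
    simp only [Sum.elim_inr] at h3
    rw [Measure.map_apply (by fun_prop) (measurableSet_Ioi.prod measurableSet_Iio),
      Measure.prod_prod] at h3
    exact h3
  rw [h2]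
  exact ENNReal.mul_pos (hν.right_pos a ha).ne' (hν.left_pos a ha).ne'

/-- The difference of the actions of two diagonal walks that start one step apart. -/
def diagDiff (n : ℕ) (ω : ℤ ⊕ ℤ → ℝ) : ℝ :=
  ∑ i ∈ Finset.range n, (ω (.inr i) - ω (.inr (i + 1))) * ω (.inl (i + 1))

lemma measurable_diagDiff (n : ℕ) : Measurable (diagDiff n) := by
  unfold diagDiff; fun_prop

lemma diagDiff_succ (n : ℕ) (ω : ℤ ⊕ ℤ → ℝ) : diagDiff (n + 1) ω =
    diagDiff n ω + (ω (.inr n) - ω (.inr (n + 1))) * ω (.inl (n + 1)) :=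
  Finset.sum_range_succ _ _

lemma diagDiff_flip (n : ℕ) (ω : ℤ ⊕ ℤ → ℝ) : diagDiff n (flip (n + 1) ω) = diagDiff n ω := by
  refine Finset.sum_congr rfl fun i hi => ?_
  have := Finset.mem_range.1 hi
  rw [flip_inr, flip_inr, flip_inl_of_ne (by omega)]

lemma abs_pot_sub_le {ω : ℤ ⊕ ℤ → ℝ} (hω : ω ∈ goodConf c) (x y : ℤ) :
    |ω (.inr x) - ω (.inr y)| ≤ 2 * c := by
  have h1 := abs_le.1 (hω.2 x)
  have h2 := abs_le.1 (hω.2 y)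
  rw [abs_le]
  constructor <;> linarith

lemma abs_diagDiff_le {ω : ℤ ⊕ ℤ → ℝ} (hω : ω ∈ goodConf c) (n : ℕ) :
    |diagDiff n ω| ≤ 2 * c * n := by
  induction n with
  | zero => simp [diagDiff]
  | succ n ih =>
    rw [diagDiff_succ]
    refine (abs_add_le _ _).trans ?_
    have h1 : |(ω (.inr n) - ω (.inr (n + 1))) * ω (.inl (n + 1))| ≤ 2 * c * 1 := by
      rw [abs_mul]
      exact mul_le_mul (abs_pot_sub_le hω _ _) (abs_sign_le hω _) (abs_nonneg _)
        ((abs_nonneg _).trans (abs_pot_sub_le hω 0 0))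
    push_cast
    linarith

lemma integrable_diagDiff_pow (hν : IsSiteLaw c ν) (n p : ℕ) :
    Integrable (fun ω => diagDiff n ω ^ p) (envLaw ν) :=
  integrable_of_goodConf_bound hν ((measurable_diagDiff n).pow_const p) ((2 * c * n) ^ p)
    fun ω hω => by
      rw [abs_pow]
      exact pow_le_pow_left₀ (abs_nonneg _) (abs_diagDiff_le hω n) p

/-- The variance of a difference of two spatial potentials. -/
noncomputable def potVar (ν : Measure ℝ) : ℝ :=
  ∫ ω, (ω (.inr 0) - ω (.inr 1)) ^ 2 ∂envLaw ν

lemma integrable_pot_sub_pow (hν : IsSiteLaw c ν) (x y : ℤ) (p : ℕ) :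
    Integrable (fun ω => (ω (.inr x) - ω (.inr y)) ^ p) (envLaw ν) :=
  integrable_of_goodConf_bound hν (by fun_prop) ((2 * c) ^ p) fun ω hω => by
    rw [abs_pow]
    exact pow_le_pow_left₀ (abs_nonneg _) (abs_pot_sub_le hω x y) p

lemma potVar_pos (hν : IsSiteLaw c ν) (hc : 0 < c) : 0 < potVar ν := by
  rw [potVar, integral_pos_iff_support_of_nonneg (fun _ => sq_nonneg _)
    (integrable_pot_sub_pow hν 0 1 2)]
  refine (measure_pair_pos hν hc).trans_le (measure_mono fun ω hω => ?_)
  rw [Function.mem_support]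
  have h1 := hω.1
  have h2 := hω.2
  have : 0 < ω (.inr 0) - ω (.inr 1) := by linarith
  positivity

lemma integral_pot_sub_sq (n : ℤ) :
    ∫ ω, (ω (.inr n) - ω (.inr (n + 1))) ^ 2 ∂envLaw ν = potVar ν := by
  have h := integral_comp_of_measurePreserving (measurePreserving_shift (ν := ν) 0 n)
    (g := fun ω => (ω (.inr 0) - ω (.inr 1)) ^ 2) (by fun_prop)
  rw [potVar, ← h]
  simp [shiftPerm, add_comm]

/-- The increments are orthogonal: the cross term is odd in the newest sign and integrates to zero,
and the square of that sign is `1`. -/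
lemma integral_diagDiff_sq (hν : IsSiteLaw c ν) (n : ℕ) :
    ∫ ω, diagDiff n ω ^ 2 ∂envLaw ν = n * potVar ν := by
  induction n with
  | zero => simp [diagDiff]
  | succ n ih =>
    set g : (ℤ ⊕ ℤ → ℝ) → ℝ := fun ω =>
      2 * diagDiff n ω * (ω (.inr n) - ω (.inr (n + 1))) * ω (.inl (n + 1)) with hg
    have hgm : Measurable g := by
      have := measurable_diagDiff n
      fun_prop
    have hg0 : ∫ ω, g ω ∂envLaw ν = 0 := integral_eq_zero_of_flip hgm (n + 1) fun ω => by
      simp [hg, diagDiff_flip]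
    have hsum : Integrable (fun ω => diagDiff n ω ^ 2 +
        (ω (.inr n) - ω (.inr (n + 1))) ^ 2) (envLaw ν) :=
      (integrable_diagDiff_pow hν n 2).add (integrable_pot_sub_pow hν n (n + 1) 2)
    have e : ∀ᵐ ω ∂envLaw ν, diagDiff (n + 1) ω ^ 2 =
        (diagDiff n ω ^ 2 + (ω (.inr n) - ω (.inr (n + 1))) ^ 2) + g ω := by
      filter_upwards [ae_goodConf hν] with ω hω
      have hs : ω (.inl (n + 1)) ^ 2 = 1 := by rcases hω.1 (n + 1) with h | h <;> simp [h]
      rw [diagDiff_succ, add_sq, mul_pow, hs]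
      simp only [hg]
      ring
    have hgi : Integrable g (envLaw ν) := by
      have : Integrable (fun ω => diagDiff (n + 1) ω ^ 2 -
          (diagDiff n ω ^ 2 + (ω (.inr n) - ω (.inr (n + 1))) ^ 2)) (envLaw ν) :=
        (integrable_diagDiff_pow hν (n + 1) 2).sub hsum
      refine this.congr ?_
      filter_upwards [e] with ω hω
      rw [hω]
      ring
    rw [integral_congr_ae e, integral_add hsum hgi, hg0,
      integral_add (integrable_diagDiff_pow hν n 2) (integrable_pot_sub_pow hν n (n + 1) 2), ih,
      integral_pot_sub_sq]
    push_cast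
    ring

/-- In the expansion of the fourth power the terms odd in the newest sign vanish in the mean. With
`D = (2 * c) ^ 2` the rest adds at most `6 * n * D ^ 2 + D ^ 2`, which fits into the increment of `3
* n ^ 2 * D ^ 2`. -/
lemma integral_diagDiff_pow_four_le (hν : IsSiteLaw c ν) (n : ℕ) :
    ∫ ω, diagDiff n ω ^ 4 ∂envLaw ν ≤ 3 * n ^ 2 * (2 * c) ^ 4 := by
  have hsq : ∀ ω ∈ goodConf c, ∀ n : ℕ, (ω (.inr n) - ω (.inr (n + 1))) ^ 2 ≤ (2 * c) ^ 2 :=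
    fun ω hω n => sq_le_sq' (by linarith [abs_le.1 (abs_pot_sub_le hω n (n + 1))])
      (abs_le.1 (abs_pot_sub_le hω n (n + 1))).2
  have hvar : potVar ν ≤ (2 * c) ^ 2 := by
    have := integral_mono_ae (μ := envLaw ν) (integrable_pot_sub_pow hν 0 1 2)
      (integrable_const ((2 * c) ^ 2)) (by
        filter_upwards [ae_goodConf hν] with ω hω
        simpa using hsq ω hω 0)
    simpa [potVar] using this
  induction n with
  | zero => simp [diagDiff]
  | succ n ih =>
    set g : (ℤ ⊕ ℤ → ℝ) → ℝ := fun ω =>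
      4 * diagDiff n ω ^ 3 * (ω (.inr n) - ω (.inr (n + 1))) * ω (.inl (n + 1)) +
      4 * diagDiff n ω * (ω (.inr n) - ω (.inr (n + 1))) ^ 3 * ω (.inl (n + 1)) ^ 3 with hg
    have hgm : Measurable g := by
      have := measurable_diagDiff n
      fun_prop
    have hg0 : ∫ ω, g ω ∂envLaw ν = 0 := integral_eq_zero_of_flip hgm (n + 1) fun ω => by
      simp only [hg, diagDiff_flip, flip_inr, flip_inl_self]
      ring
    set D := (2 * c) ^ 2 with hD
    have e : ∀ ω ∈ goodConf c, |diagDiff (n + 1) ω ^ 4 - diagDiff n ω ^ 4 - g ω| ≤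
        6 * D * diagDiff n ω ^ 2 + D ^ 2 := by
      intro ω hω
      have hs : ω (.inl (n + 1)) ^ 2 = 1 := by rcases hω.1 (n + 1) with h | h <;> simp [h]
      have hs4 : ω (.inl (n + 1)) ^ 4 = 1 := by rcases hω.1 (n + 1) with h | h <;> norm_num [h]
      have h1 := hsq ω hω n
      rw [diagDiff_succ]
      simp only [hg]
      set z := diagDiff n ω
      set d := ω (.inr n) - ω (.inr (n + 1))
      set s := ω (.inl (n + 1))
      have e1 : (z + d * s) ^ 4 - z ^ 4 - (4 * z ^ 3 * d * s + 4 * z * d ^ 3 * s ^ 3) =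
          6 * d ^ 2 * z ^ 2 * s ^ 2 + (d ^ 2) ^ 2 * s ^ 4 := by ring
      rw [e1, hs, hs4, mul_one, mul_one, abs_of_nonneg (by positivity)]
      gcongr
    have hgi : Integrable g (envLaw ν) := by
      have h4 : Integrable (fun ω => diagDiff (n + 1) ω ^ 4 - diagDiff n ω ^ 4) (envLaw ν) :=
        (integrable_diagDiff_pow hν (n + 1) 4).sub (integrable_diagDiff_pow hν n 4)
      have h5 : Integrable (fun ω => diagDiff (n + 1) ω ^ 4 - diagDiff n ω ^ 4 - g ω)
          (envLaw ν) := by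
        refine Integrable.mono' (g := fun ω => 6 * D * diagDiff n ω ^ 2 + D ^ 2)
          (((integrable_diagDiff_pow hν n 2).const_mul _).add (integrable_const _)) ?_ ?_
        · have := measurable_diagDiff n
          have := measurable_diagDiff (n + 1)
          exact Measurable.aestronglyMeasurable (by fun_prop)
        · filter_upwards [ae_goodConf hν] with ω hω using e ω hω
      refine (h4.sub h5).congr (Eventually.of_forall fun ω => ?_)
      simp
    have hi1 : Integrable (fun ω => diagDiff n ω ^ 4 + g ω) (envLaw ν) :=
      (integrable_diagDiff_pow hν n 4).add hgi
    have hi2 : Integrable (fun ω => 6 * D * diagDiff n ω ^ 2 + D ^ 2) (envLaw ν) :=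
      ((integrable_diagDiff_pow hν n 2).const_mul _).add (integrable_const _)
    calc ∫ ω, diagDiff (n + 1) ω ^ 4 ∂envLaw ν
        ≤ ∫ ω, (diagDiff n ω ^ 4 + g ω) + (6 * D * diagDiff n ω ^ 2 + D ^ 2) ∂envLaw ν := by
          refine integral_mono_ae (integrable_diagDiff_pow hν (n + 1) 4) (hi1.add hi2) ?_
          filter_upwards [ae_goodConf hν] with ω hω
          linarith [(abs_le.1 (e ω hω)).2]
      _ = ∫ ω, diagDiff n ω ^ 4 ∂envLaw ν + 6 * D * (n * potVar ν) + D ^ 2 := by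
          rw [integral_add hi1 hi2, integral_add (integrable_diagDiff_pow hν n 4) hgi, hg0,
            integral_add ((integrable_diagDiff_pow hν n 2).const_mul _) (integrable_const _),
            integral_const_mul, integral_diagDiff_sq hν]
          simp
          ring
      _ ≤ 3 * ((n + 1 : ℕ) : ℝ) ^ 2 * (2 * c) ^ 4 := by
          have h1 : (2 * c) ^ 4 = D ^ 2 := by rw [hD]; ring
          have hD0 : 0 ≤ D := sq_nonneg _
          rw [h1] at ih ⊢
          have h2 : 6 * D * (n * potVar ν) ≤ 6 * D * (n * D) := by gcongr
          push_cast
          nlinarith [sq_nonneg D]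

/-- The mean of `|diagDiff n|` is unbounded in `n`. -/
lemma exists_lt_integral_abs_diagDiff (hν : IsSiteLaw c ν) (hc : 0 < c) (K : ℝ) :
    ∃ n : ℕ, 0 < n ∧ K < ∫ ω, |diagDiff n ω| ∂envLaw ν := by
  set v := potVar ν with hv
  have hv0 : 0 < v := potVar_pos hν hc
  set D := (2 * c) ^ 4 with hD
  have hD0 : 0 < D := by positivity
  set M := 1 + 6 * D / v with hM
  have hM1 : 1 ≤ M := by
    have : 0 ≤ 6 * D / v := by positivity
    linarith
  have hMv : 6 * D ≤ M ^ 2 * v := by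
    have h1 : 6 * D ≤ M * v := by
      rw [hM, add_mul, div_mul_cancel₀ _ hv0.ne']
      linarith
    nlinarith
  obtain ⟨m, hm⟩ := exists_nat_gt (max 1 (K * (2 * M) / v))
  have hm1 : (1 : ℝ) < m := (le_max_left _ _).trans_lt hm
  have hm2 := (le_max_right _ _).trans_lt hm
  rw [div_lt_iff₀ hv0] at hm2
  have hm0 : 0 < m := by
    have : (0 : ℝ) < m := by linarith
    exact_mod_cast this
  refine ⟨m ^ 2, by positivity, ?_⟩
  -- For `n = m ^ 2` typical values of `diagDiff` are of order `m`. At the scale `s = M * m` the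
  -- bound `z ^ 2 / s - z ^ 4 / s ^ 3 ≤ |z|` has mean at least `m * (v / M - 3 * D / M ^ 3)`, and
  -- `M` is chosen so that the fourth moment consumes at most half of the variance term.
  set s := M * m with hs
  have hs0 : 0 < s := by positivity
  have hpt : ∀ z : ℝ, (1 / s) * z ^ 2 - (1 / s ^ 3) * z ^ 4 ≤ |z| := by
    intro z
    have h1 : (1 / s) * z ^ 2 - (1 / s ^ 3) * z ^ 4 = s * ((|z| / s) ^ 2 - (|z| / s) ^ 4) := by
      have h4 : |z| ^ 4 = z ^ 4 := by
        rw [show |z| ^ 4 = (|z| ^ 2) ^ 2 by ring, sq_abs]; ring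
      rw [div_pow, div_pow, sq_abs, h4]
      field_simp
    have h2 : |z| = s * (|z| / s) := by field_simp
    rw [h1]
    conv_rhs => rw [h2]
    refine mul_le_mul_of_nonneg_left ?_ hs0.le
    have ht : 0 ≤ |z| / s := by positivity
    set t := |z| / s
    rcases le_total t 1 with h | h
    · nlinarith [pow_nonneg ht 4]
    · nlinarith [pow_le_pow_right₀ h (show 2 ≤ 4 by norm_num)]
  have habs : Integrable (fun ω => |diagDiff (m ^ 2) ω|) (envLaw ν) := by
    simpa using (integrable_diagDiff_pow hν (m ^ 2) 1).abs
  have hi2 := (integrable_diagDiff_pow hν (m ^ 2) 2).const_mul (1 / s)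
  have hi4 := (integrable_diagDiff_pow hν (m ^ 2) 4).const_mul (1 / s ^ 3)
  have h1 := integral_mono (hi2.sub hi4) habs fun ω => hpt _
  rw [integral_sub' hi2 hi4, integral_const_mul, integral_const_mul, integral_diagDiff_sq hν] at h1
  have h4 := integral_diagDiff_pow_four_le hν (m ^ 2)
  have h5 : (1 / s ^ 3) * ∫ ω, diagDiff (m ^ 2) ω ^ 4 ∂envLaw ν ≤
      (1 / s ^ 3) * (3 * ((m ^ 2 : ℕ) : ℝ) ^ 2 * D) := by gcongr
  have h6 : K < (1 / s) * (((m ^ 2 : ℕ) : ℝ) * v) -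
      (1 / s ^ 3) * (3 * ((m ^ 2 : ℕ) : ℝ) ^ 2 * D) := by
    have e : (1 / s) * (((m ^ 2 : ℕ) : ℝ) * v) -
        (1 / s ^ 3) * (3 * ((m ^ 2 : ℕ) : ℝ) ^ 2 * D) = m * (M ^ 2 * v - 3 * D) / M ^ 3 := by
      rw [hs]; push_cast; field_simp
    rw [e, lt_div_iff₀ (by positivity)]
    have h7 : m * (M ^ 2 * v / 2) ≤ m * (M ^ 2 * v - 3 * D) := by
      gcongr; linarith
    have h8 : K * M ^ 3 < m * (M ^ 2 * v / 2) := by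
      have : K * M ^ 3 = (K * (2 * M)) * (M ^ 2 / 2) := by ring
      have h9 : (K * (2 * M)) * (M ^ 2 / 2) < (m * v) * (M ^ 2 / 2) := by gcongr
      linarith
    linarith
  linarith

/-- One pause on the way gains an arbitrary amount on average, if the way is long. -/
lemma exists_meanAction_pause_lt (hν : IsSiteLaw c ν) (hc : 0 < c) :
    ∃ n : ℕ, 0 < n ∧ meanAction ν (n + 1) n < -c := by
  -- The smaller of two variables is half of their sum minus the modulus of their difference. The
  -- sum has mean zero, so `2 * c` is the threshold for a gain above `c`.
  obtain ⟨n, hn0, hn⟩ := exists_lt_integral_abs_diagDiff hν hc (2 * c)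
  refine ⟨n, hn0, ?_⟩
  set X : (ℤ ⊕ ℤ → ℝ) → ℝ := fun ω =>
    ∑ i ∈ Finset.range (n + 1), ω (.inr (i : ℤ)) * ω (.inl (i + 1)) with hX
  set Y : (ℤ ⊕ ℤ → ℝ) → ℝ := fun ω =>
    ∑ i ∈ Finset.range n, ω (.inr (i + 1)) * ω (.inl (i + 1)) + ω (.inr n) * ω (.inl (n + 1))
    with hY
  have hXi : Integrable X (envLaw ν) :=
    integrable_finsetSum _ fun i _ => integrable_pot_mul_sign hν _ _
  have hYi1 : Integrable (fun ω : ℤ ⊕ ℤ → ℝ =>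
      ∑ i ∈ Finset.range n, ω (.inr (i + 1)) * ω (.inl (i + 1))) (envLaw ν) :=
    integrable_finsetSum _ fun i _ => integrable_pot_mul_sign hν _ _
  have hYi : Integrable Y (envLaw ν) := hYi1.add (integrable_pot_mul_sign hν _ _)
  have hX0 : ∫ ω, X ω ∂envLaw ν = 0 := integral_sum_pot_mul_sign hν (fun i => i) (n + 1)
  have hY0 : ∫ ω, Y ω ∂envLaw ν = 0 := by
    rw [hY, integral_add hYi1 (integrable_pot_mul_sign hν _ _),
      integral_sum_pot_mul_sign hν (fun i => i + 1) n, integral_pot_mul_sign, add_zero]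
  have hXY : ∀ ω, X ω - Y ω = diagDiff n ω := by
    intro ω
    simp only [hX, hY, diagDiff, Finset.sum_range_succ, sub_mul, Finset.sum_sub_distrib]
    ring
  have habs : Integrable (fun ω => |diagDiff n ω|) (envLaw ν) := by
    simpa using (integrable_diagDiff_pow hν n 1).abs
  have hle : ∀ ω, confAction (n + 1) n ω ≤ (1 / 2) * (X ω + Y ω - |diagDiff n ω|) := by
    intro ω
    have h1 := minAction_pause_first_le (fun i => ω (.inl i)) (fun x => ω (.inr x)) n
    have h2 := minAction_pause_last_le (fun i => ω (.inl i)) (fun x => ω (.inr x)) n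
    rw [← hXY]
    change confAction (n + 1) n ω ≤ X ω at h1
    change confAction (n + 1) n ω ≤ Y ω at h2
    rcases abs_cases (X ω - Y ω) with h | h <;> linarith
  have hXYi : Integrable (fun ω => X ω + Y ω) (envLaw ν) := hXi.add hYi
  have hn1 : |(n : ℤ)| ≤ (n + 1 : ℕ) := by simp
  have h1 := integral_mono (integrable_confAction hν hn1)
    ((hXYi.sub habs).const_mul (1 / 2)) hle
  have h2 : ∫ ω, (1 / 2 : ℝ) * ((fun ω => X ω + Y ω) - fun ω => |diagDiff n ω|) ω ∂envLaw ν =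
      (1 / 2) * (0 - ∫ ω, |diagDiff n ω| ∂envLaw ν) := by
    rw [integral_const_mul, integral_sub' hXYi habs, integral_add hXi hYi, hX0, hY0, add_zero]
  have h3 := h1.trans_eq h2
  unfold meanAction
  linarith

/-- The average amount by which the potential of a site stays off its extreme values. -/
noncomputable def siteGap (c : ℝ) (ν : Measure ℝ) : ℝ := ∫ y, (c - |y|) ∂ν

lemma siteGap_pos (hν : IsSiteLaw c ν) : 0 < siteGap c ν := by
  have hi : Integrable (fun y : ℝ => c - |y|) ν := by
    refine Integrable.of_bound (Measurable.aestronglyMeasurable (by fun_prop)) c ?_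
    filter_upwards [hν.ae_abs_le] with y hy
    rw [Real.norm_eq_abs, abs_of_nonneg (by linarith)]
    linarith [abs_nonneg y]
  rw [siteGap, integral_pos_iff_support_of_nonneg_ae ?_ hi]
  · refine hν.interior_pos.trans_le (measure_mono fun y hy => ?_)
    rw [Function.mem_support]
    have := abs_lt.2 hy
    linarith
  · filter_upwards [hν.ae_abs_le] with y hy
    simpa using hy

lemma le_meanAction (hν : IsSiteLaw c ν) {n : ℕ} {k : ℤ} (hk : |k| ≤ n) (hk0 : 0 ≤ k) :
    -c * n + siteGap c ν * k ≤ meanAction ν n k := by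
  have hi : ∀ x : ℤ, Integrable (fun ω : ℤ ⊕ ℤ → ℝ => c - |ω (.inr x)|) (envLaw ν) := fun x =>
    integrable_of_goodConf_bound hν (by fun_prop) c fun ω hω => by
      rw [abs_of_nonneg (by linarith [hω.2 x])]
      linarith [abs_nonneg (ω (.inr x))]
  have hint : ∀ x : ℤ, ∫ ω, (c - |ω (.inr x)|) ∂envLaw ν = siteGap c ν := by
    intro x
    have hmp := measurePreserving_eval (ν := ν) (.inr x)
    simp only [Sum.elim_inr] at hmp
    have h := integral_map (μ := envLaw ν) (f := fun y : ℝ => c - |y|)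
      hmp.measurable.aemeasurable (Measurable.aestronglyMeasurable (by fun_prop))
    rw [hmp.map_eq] at h
    exact h.symm
  have hsum : Integrable (fun ω : ℤ ⊕ ℤ → ℝ => ∑ x ∈ Finset.Ioc 0 k, (c - |ω (.inr x)|))
      (envLaw ν) := integrable_finsetSum _ fun x _ => hi x
  have h1 := integral_mono_ae ((integrable_const (-c * n)).add hsum) (integrable_confAction hν hk)
    (by
      filter_upwards [ae_goodConf hν] with ω hω
      exact le_minAction_of_visits hω.2 (abs_sign_le hω) hk)
  rw [integral_add' (integrable_const _) hsum, integral_finsetSum _ fun x _ => hi x] at h1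
  simp only [hint, Finset.sum_const, Int.card_Ioc, sub_zero, nsmul_eq_mul, integral_const,
    probReal_univ, one_smul] at h1
  have h2 : ((k.toNat : ℕ) : ℝ) = k := by exact_mod_cast Int.toNat_of_nonneg hk0
  rw [h2] at h1
  unfold meanAction
  linarith

/-- Averaging over the flip of the newest sign leaves the past action unchanged and turns the new
factor into a hyperbolic cosine, at most `cosh (t * c)`. -/
lemma integral_exp_flip_le (hν : IsSiteLaw c ν) (hc : 0 < c) {n : ℕ} {j : ℤ} (hj : |j| ≤ n)
    (k : ℤ) {t : ℝ} (ht : 0 < t) :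
    ∫ ω, Real.exp (-t * confAction n j ω) * Real.exp (-t * (ω (.inr k) * ω (.inl (n + 1))))
      ∂envLaw ν ≤ Real.cosh (t * c) * ∫ ω, Real.exp (-t * confAction n j ω) ∂envLaw ν := by
  set G : (ℤ ⊕ ℤ → ℝ) → ℝ := fun ω => Real.exp (-t * confAction n j ω) with hG
  set g : (ℤ ⊕ ℤ → ℝ) → ℝ := fun ω =>
    G ω * Real.exp (-t * (ω (.inr k) * ω (.inl (n + 1)))) with hg
  have hAm := measurable_confAction n j
  have hGm : Measurable G := by fun_prop
  have hgm : Measurable g := by fun_prop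
  have hGle : ∀ ω ∈ goodConf c, G ω ≤ Real.exp (t * (c * n)) := fun ω hω => by
    refine Real.exp_le_exp.2 ?_
    have := (abs_le.1 (abs_confAction_le hω hj)).1
    nlinarith
  have hGi : Integrable G (envLaw ν) :=
    integrable_of_goodConf_bound hν hGm _ fun ω hω => by
      rw [abs_of_pos (Real.exp_pos _)]; exact hGle ω hω
  have hb : ∀ ω ∈ goodConf c, |ω (.inr k) * ω (.inl (n + 1))| ≤ c := fun ω hω => by
    rw [abs_mul]
    calc _ ≤ c * 1 := mul_le_mul (hω.2 _) (abs_sign_le hω _) (abs_nonneg _) hc.le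
      _ = c := mul_one c
  have hgi : Integrable g (envLaw ν) :=
    integrable_of_goodConf_bound hν hgm (Real.exp (t * (c * n)) * Real.exp (t * c))
      fun ω hω => by
      rw [abs_of_pos (by positivity)]
      refine mul_le_mul (hGle ω hω) (Real.exp_le_exp.2 ?_) (Real.exp_pos _).le (Real.exp_pos _).le
      have := (abs_le.1 (hb ω hω)).1
      nlinarith
  have hmp := measurePreserving_flip (ν := ν) (n + 1)
  have hflip := integral_comp_of_measurePreserving hmp hgm
  have hgi' : Integrable (fun ω => g (flip (n + 1) ω)) (envLaw ν) :=
    hmp.integrable_comp_of_integrable hgi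
  have h1 : ∫ ω, (g ω + g (flip (n + 1) ω)) ∂envLaw ν ≤
      ∫ ω, (2 * Real.cosh (t * c)) * G ω ∂envLaw ν := by
    refine integral_mono_ae (hgi.add hgi') (hGi.const_mul _) ?_
    filter_upwards [ae_goodConf hν] with ω hω
    have e : g ω + g (flip (n + 1) ω) =
        2 * Real.cosh (t * (ω (.inr k) * ω (.inl (n + 1)))) * G ω := by
      simp only [hg, hG]
      rw [confAction_flip (by simp), flip_inr, flip_inl_self, Real.cosh_eq]
      ring_nf
    rw [e]
    have hle : Real.cosh (t * (ω (.inr k) * ω (.inl (n + 1)))) ≤ Real.cosh (t * c) := by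
      rw [Real.cosh_le_cosh, abs_mul, abs_mul t c]
      exact mul_le_mul_of_nonneg_left ((hb ω hω).trans (le_abs_self c)) (abs_nonneg t)
    have : 0 ≤ G ω := (Real.exp_pos _).le
    gcongr
  rw [integral_add hgi hgi', hflip, integral_const_mul] at h1
  linarith

/-- The exponential moment of the minimal action, which counts the lazy walks with a weight
`exp (θ (γ (i + 1) - γ i))` at each step. -/
lemma integral_exp_confAction_le (hν : IsSiteLaw c ν) (hc : 0 < c) {t : ℝ} (ht : 0 < t) (θ : ℝ)
    {n : ℕ} {k : ℤ} (hk : |k| ≤ n) :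
    ∫ ω, Real.exp (-t * confAction n k ω) ∂envLaw ν ≤ Real.exp (-θ * k) *
      (Real.cosh (t * c) * (Real.exp θ + 1 + Real.exp (-θ))) ^ n := by
  have hint : ∀ (n : ℕ) (j : ℤ), |j| ≤ n →
      Integrable (fun ω => Real.exp (-t * confAction n j ω)) (envLaw ν) := fun n j hj => by
    have := measurable_confAction n j
    refine integrable_of_goodConf_bound hν (by fun_prop) (Real.exp (t * (c * n))) fun ω hω => ?_
    rw [abs_of_pos (Real.exp_pos _)]
    refine Real.exp_le_exp.2 ?_
    have := (abs_le.1 (abs_confAction_le hω hj)).1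
    nlinarith
  induction n generalizing k with
  | zero =>
    obtain rfl : k = 0 := by simpa using hk
    simp [confAction, minAction_zero]
  | succ n ih =>
    set R := Real.cosh (t * c) * (Real.exp θ + 1 + Real.exp (-θ)) with hR
    have hR0 : 0 ≤ R := by
      have := Real.cosh_pos (t * c)
      positivity
    set S : Finset ℤ := (Finset.Icc (k - 1) (k + 1)).filter fun j => |j| ≤ n with hS
    have hSm : ∀ j ∈ S, |j| ≤ n := fun j hj => (Finset.mem_filter.1 hj).2
    set g : ℤ → (ℤ ⊕ ℤ → ℝ) → ℝ := fun j ω => Real.exp (-t * confAction n j ω) *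
      Real.exp (-t * (ω (.inr k) * ω (.inl (n + 1)))) with hg
    have hgi : ∀ j ∈ S, Integrable (g j) (envLaw ν) := fun j hj => by
      have := measurable_confAction n j
      refine integrable_of_goodConf_bound hν (by fun_prop)
        (Real.exp (t * (c * n)) * Real.exp (t * c)) fun ω hω => ?_
      rw [abs_of_pos (by positivity)]
      refine mul_le_mul (Real.exp_le_exp.2 ?_) (Real.exp_le_exp.2 ?_) (Real.exp_pos _).le
        (Real.exp_pos _).le
      · have := (abs_le.1 (abs_confAction_le hω (hSm j hj))).1
        nlinarith
      · have h1 : |ω (.inr k) * ω (.inl (n + 1))| ≤ c * 1 := by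
          rw [abs_mul]
          exact mul_le_mul (hω.2 _) (abs_sign_le hω _) (abs_nonneg _) hc.le
        have := (abs_le.1 h1).1
        nlinarith
    -- The optimal predecessor depends on the configuration, so it is bounded by the sum over all at
    -- most three candidates. This is where the number of walks enters.
    have hpt : ∀ ω, Real.exp (-t * confAction (n + 1) k ω) ≤ ∑ j ∈ S, g j ω := by
      intro ω
      obtain ⟨j, h1, h2, h3⟩ := exists_minAction_succ (fun i => ω (.inl i))
        (fun x => ω (.inr x)) hk
      have hjS : j ∈ S := by
        rw [hS, Finset.mem_filter, Finset.mem_Icc]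
        rw [abs_le] at h2
        exact ⟨⟨by omega, by omega⟩, h1⟩
      have h4 : Real.exp (-t * confAction (n + 1) k ω) = g j ω := by
        simp only [hg]
        rw [← Real.exp_add, confAction, h3, confAction]
        ring_nf
      rw [h4]
      exact Finset.single_le_sum (f := fun j => g j ω) (fun j _ => by positivity) hjS
    calc ∫ ω, Real.exp (-t * confAction (n + 1) k ω) ∂envLaw ν
        ≤ ∫ ω, ∑ j ∈ S, g j ω ∂envLaw ν :=
          integral_mono (hint _ _ hk) (integrable_finsetSum _ hgi) hpt
      _ = ∑ j ∈ S, ∫ ω, g j ω ∂envLaw ν := integral_finsetSum _ hgi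
      _ ≤ ∑ j ∈ S, Real.cosh (t * c) * (Real.exp (-θ * j) * R ^ n) := by
          refine Finset.sum_le_sum fun j hj => ?_
          refine (integral_exp_flip_le hν hc (hSm j hj) k ht).trans ?_
          exact mul_le_mul_of_nonneg_left (ih (hSm j hj)) (Real.cosh_pos _).le
      _ ≤ ∑ j ∈ Finset.Icc (k - 1) (k + 1), Real.cosh (t * c) * (Real.exp (-θ * j) * R ^ n) := by
          refine Finset.sum_le_sum_of_subset_of_nonneg (Finset.filter_subset _ _) fun j _ _ => ?_
          have := Real.cosh_pos (t * c)
          positivity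
      _ = Real.exp (-θ * k) * R ^ (n + 1) := by
          have e : Finset.Icc (k - 1) (k + 1) = {k - 1, k, k + 1} := by
            ext x
            simp only [Finset.mem_Icc, Finset.mem_insert, Finset.mem_singleton]
            omega
          rw [e, Finset.sum_insert (by simp; omega), Finset.sum_insert (by simp),
            Finset.sum_singleton]
          push_cast
          have e1 : Real.exp (-θ * (k - 1)) = Real.exp (-θ * k) * Real.exp θ := by
            rw [← Real.exp_add]; ring_nf
          have e2 : Real.exp (-θ * (k + 1)) = Real.exp (-θ * k) * Real.exp (-θ) := by
            rw [← Real.exp_add]; ring_nf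
          rw [e1, e2, pow_succ]
          nth_rw 5 [hR]
          ring

/-- Jensen's inequality for the exponential moment, in the form `x + 1 ≤ exp x`. Factoring `exp θ`
out of the step weights leaves at most `exp (2 * exp (-θ))`, so for large `θ` and `k` near `n` the
count of walks is small; the signs contribute `exp ((t * c) ^ 2 / 2)` a step. -/
lemma neg_meanAction_le (hν : IsSiteLaw c ν) (hc : 0 < c) {t : ℝ} (ht : 0 < t) {θ : ℝ}
    (hθ : 0 ≤ θ) {n : ℕ} {k : ℤ} (hk : |k| ≤ n) :
    -meanAction ν n k ≤
      (θ * (n - k) + n * ((t * c) ^ 2 / 2 + 2 * Real.exp (-θ))) / t := by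
  set s := θ * (n - k) + n * ((t * c) ^ 2 / 2 + 2 * Real.exp (-θ)) with hs
  have h1 := integral_exp_confAction_le hν hc ht θ hk
  have h2 : Real.cosh (t * c) * (Real.exp θ + 1 + Real.exp (-θ)) ≤
      Real.exp ((t * c) ^ 2 / 2 + (θ + 2 * Real.exp (-θ))) := by
    rw [Real.exp_add]
    refine mul_le_mul (Real.cosh_le_exp_half_sq _) ?_ (by positivity) (Real.exp_pos _).le
    have h3 : Real.exp (-θ) ≤ 1 := Real.exp_le_one_iff.2 (by linarith)
    have h4 : Real.exp θ * Real.exp (-θ) = 1 := by rw [← Real.exp_add]; simp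
    have h5 : Real.exp θ * (2 * Real.exp (-θ) + 1) ≤ Real.exp (θ + 2 * Real.exp (-θ)) := by
      rw [Real.exp_add]
      exact mul_le_mul_of_nonneg_left (Real.add_one_le_exp _) (Real.exp_pos _).le
    nlinarith
  have h3 : ∫ ω, Real.exp (-t * confAction n k ω) ∂envLaw ν ≤ Real.exp s := by
    refine h1.trans ?_
    refine (mul_le_mul_of_nonneg_left (pow_le_pow_left₀ (by
      have := Real.cosh_pos (t * c); positivity) h2 n) (Real.exp_pos _).le).trans_eq ?_
    rw [← Real.exp_nat_mul, ← Real.exp_add, hs]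
    ring_nf
  have hm := measurable_confAction n k
  have hexp : Integrable (fun ω => Real.exp (-t * confAction n k ω)) (envLaw ν) := by
    refine integrable_of_goodConf_bound hν (by fun_prop) (Real.exp (t * (c * n))) fun ω hω => ?_
    rw [abs_of_pos (Real.exp_pos _)]
    refine Real.exp_le_exp.2 ?_
    have := (abs_le.1 (abs_confAction_le hω hk)).1
    nlinarith
  have h4 : ∫ ω, -t * confAction n k ω ∂envLaw ν ≤
      ∫ ω, (Real.exp (-s) * Real.exp (-t * confAction n k ω) + (s - 1)) ∂envLaw ν := by
    refine integral_mono ((integrable_confAction hν hk).const_mul _)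
      ((hexp.const_mul _).add (integrable_const _)) fun ω => ?_
    simp only
    rw [← Real.exp_add]
    linarith [Real.add_one_le_exp (-s + -t * confAction n k ω)]
  rw [integral_const_mul, integral_add (hexp.const_mul _) (integrable_const _),
    integral_const_mul] at h4
  have h5 : Real.exp (-s) * ∫ ω, Real.exp (-t * confAction n k ω) ∂envLaw ν ≤ 1 := by
    refine (mul_le_mul_of_nonneg_left h3 (Real.exp_pos _).le).trans_eq ?_
    rw [← Real.exp_add]; simp
  simp only [integral_const, probReal_univ, one_smul] at h4
  rw [le_div_iff₀ ht]
  unfold meanAction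
  linarith

end Moments

/-! ### Rounding towards zero. -/

section Rounding

lemma abs_roundToZero_sub_le (x : ℝ) : |(roundToZero x : ℝ) - x| ≤ 1 := by
  unfold roundToZero
  split_ifs with h
  · rw [abs_le]
    constructor <;> linarith [Int.floor_le x, Int.lt_floor_add_one x]
  · push_cast
    rw [abs_le]
    constructor <;> linarith [Int.floor_le (-x), Int.lt_floor_add_one (-x)]

lemma roundToZero_intCast (k : ℤ) : roundToZero k = k := by
  unfold roundToZero
  split_ifs <;> simp [← Int.cast_neg]

lemma roundToZero_neg (x : ℝ) : roundToZero (-x) = -roundToZero x := by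
  unfold roundToZero
  rcases lt_trichotomy x 0 with h | rfl | h
  · rw [if_pos (by linarith), if_neg (by linarith), neg_neg]
  · simp
  · rw [if_neg (by linarith), if_pos h.le, neg_neg]

lemma roundToZero_nonneg {x : ℝ} (hx : 0 ≤ x) : 0 ≤ roundToZero x := by
  rw [roundToZero, if_pos hx]
  exact Int.floor_nonneg.2 hx

lemma abs_roundToZero_le {x : ℝ} {n : ℕ} (hx : |x| ≤ n) : |roundToZero x| ≤ n := by
  have key : ∀ y : ℝ, 0 ≤ y → y ≤ n → |⌊y⌋| ≤ (n : ℤ) := by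
    intro y h0 h1
    rw [abs_of_nonneg (Int.floor_nonneg.2 h0)]
    have : ⌊y⌋ ≤ ⌊(n : ℝ)⌋ := Int.floor_mono h1
    simpa using this
  rw [abs_le] at hx
  unfold roundToZero
  split_ifs with h
  · exact key x h hx.2
  · rw [abs_neg]
    exact key (-x) (by linarith) (by linarith)

lemma abs_roundToZero_mul_le {α : ℝ} (hα : α ∈ Icc (-1 : ℝ) 1) (n : ℕ) :
    |roundToZero (α * n)| ≤ n := by
  refine abs_roundToZero_le ?_
  rw [abs_mul, Nat.abs_cast]
  exact mul_le_of_le_one_left (Nat.cast_nonneg n) (abs_le.2 hα)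

lemma tendsto_roundToZero_div (α : ℝ) {u : ℕ → ℕ} (hu : Tendsto u atTop atTop) :
    Tendsto (fun n => (roundToZero (α * u n) : ℝ) / u n) atTop (𝓝 α) := by
  have hu' : Tendsto (fun n => (u n : ℝ)) atTop atTop := tendsto_natCast_atTop_atTop.comp hu
  have h0 : Tendsto (fun n => 1 / (u n : ℝ)) atTop (𝓝 0) := hu'.const_div_atTop 1
  rw [tendsto_iff_norm_sub_tendsto_zero]
  refine squeeze_zero' (Eventually.of_forall fun _ => norm_nonneg _) ?_ h0
  filter_upwards [hu'.eventually_gt_atTop 0] with n hn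
  have e : (roundToZero (α * u n) : ℝ) / u n - α = (roundToZero (α * u n) - α * u n) / u n := by
    field_simp
  rw [e, norm_div, Real.norm_eq_abs, Real.norm_eq_abs, abs_of_pos hn]
  gcongr
  exact abs_roundToZero_sub_le _

end Rounding

/-! ### From rational slopes to all slopes on a single event. -/

section Limit

variable {c : ℝ} {ν : Measure ℝ}

/-- Near-constancy up to every `ε` makes each sequence Cauchy; as the constants do not depend on the
index, all limits coincide. -/
lemma exists_common_limit {ι : Type*} (G : Set ι) (u : ι → ℕ → ℝ)
    (h : ∀ ε > 0, ∃ x : ℝ, ∀ ω ∈ G, ∀ᶠ n in atTop, |u ω n - x| ≤ ε) :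
    ∃ l : ℝ, ∀ ω ∈ G, Tendsto (u ω) atTop (𝓝 l) := by
  rcases G.eq_empty_or_nonempty with rfl | ⟨ω₀, hω₀⟩
  · exact ⟨0, by simp⟩
  have hC : CauchySeq (u ω₀) := by
    rw [Metric.cauchySeq_iff']
    intro ε hε
    obtain ⟨x, hx⟩ := h (ε / 3) (by positivity)
    obtain ⟨N, hN⟩ := eventually_atTop.1 (hx ω₀ hω₀)
    refine ⟨N, fun n hn => ?_⟩
    have h1 := abs_le.1 (hN n hn)
    have h2 := abs_le.1 (hN N le_rfl)
    rw [Real.dist_eq, abs_lt]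
    constructor <;> linarith
  obtain ⟨l, hl⟩ := cauchySeq_tendsto_of_complete hC
  refine ⟨l, fun ω hω => ?_⟩
  rw [Metric.tendsto_nhds] at hl ⊢
  intro ε hε
  obtain ⟨x, hx⟩ := h (ε / 4) (by positivity)
  filter_upwards [hl (ε / 2) (by positivity), hx ω hω, hx ω₀ hω₀] with n h1 h2 h3
  rw [Real.dist_eq, abs_lt] at *
  rw [abs_le] at h2 h3
  constructor <;> linarith

/-- The good configurations for which the limits along rational slopes exist. -/
def limitConf (c : ℝ) (l : ℕ → ℤ → ℝ) : Set (ℤ ⊕ ℤ → ℝ) :=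
  {ω | ω ∈ goodConf c ∧ ∀ (q : ℕ) (p : ℤ), q ≠ 0 → p ≠ 0 → |p| ≤ q →
    Tendsto (fun n : ℕ => confAction (n * q) (n * p) ω / n) atTop (𝓝 (l q p))}

lemma exists_ae_limitConf [IsProbabilityMeasure ν] (hν : IsSiteLaw c ν) (hc : 0 < c) :
    ∃ l : ℕ → ℤ → ℝ, ∀ᵐ ω ∂envLaw ν, ω ∈ limitConf c l := by
  have h : ∀ (q : ℕ) (p : ℤ), ∃ l : ℝ, q ≠ 0 → p ≠ 0 → |p| ≤ q → ∀ᵐ ω ∂envLaw ν,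
      Tendsto (fun n : ℕ => confAction (n * q) (n * p) ω / n) atTop (𝓝 l) := by
    intro q p
    by_cases hq : q ≠ 0 ∧ p ≠ 0 ∧ |p| ≤ q
    · obtain ⟨l, hl⟩ := exists_tendsto_rational hν hc hq.1 hq.2.1 hq.2.2
      exact ⟨l, fun _ _ _ => hl⟩
    · exact ⟨0, fun h1 h2 h3 => absurd ⟨h1, h2, h3⟩ hq⟩
  choose l hl using h
  refine ⟨l, ?_⟩
  have h1 : ∀ᵐ ω ∂envLaw ν, ∀ (q : ℕ) (p : ℤ), q ≠ 0 → p ≠ 0 → |p| ≤ q →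
      Tendsto (fun n : ℕ => confAction (n * q) (n * p) ω / n) atTop (𝓝 (l q p)) := by
    rw [ae_all_iff]; intro q
    rw [ae_all_iff]; intro p
    by_cases hq : q ≠ 0 ∧ p ≠ 0 ∧ |p| ≤ q
    · filter_upwards [hl q p hq.1 hq.2.1 hq.2.2] with ω hω _ _ _ using hω
    · exact Eventually.of_forall fun ω h1 h2 h3 => absurd ⟨h1, h2, h3⟩ hq
  filter_upwards [ae_goodConf hν, h1] with ω h2 h3 using ⟨h2, h3⟩

/-- In a good configuration walks can be prolonged at a cost of at most `c` a step. -/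
lemma confAction_extend {ω : ℤ ⊕ ℤ → ℝ} (hω : ω ∈ goodConf c) {n m : ℕ} {k j : ℤ}
    (hk : |k| ≤ n) (hnm : n ≤ m) (hj : |j - k| ≤ (m - n : ℤ)) :
    confAction m j ω ≤ confAction n k ω + c * (m - n) :=
  minAction_extend hω.2 (abs_sign_le hω) hk hnm hj

lemma tendsto_confAction_div {l : ℝ} {ω : ℤ ⊕ ℤ → ℝ} {q : ℕ} {p : ℤ}
    (h : Tendsto (fun n : ℕ => confAction (n * q) (n * p) ω / n) atTop (𝓝 l)) {m : ℕ → ℕ}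
    (hm : Tendsto m atTop atTop) {a : ℝ} (ha : Tendsto (fun n => (m n : ℝ) / n) atTop (𝓝 a)) :
    Tendsto (fun n : ℕ => confAction (m n * q) (m n * p) ω / n) atTop (𝓝 (l * a)) := by
  refine ((h.comp hm).mul ha).congr' ?_
  filter_upwards [hm.eventually_gt_atTop 0] with n hn
  have : (m n : ℝ) ≠ 0 := by positivity
  simp only [Function.comp]
  field_simp

/-- Near every interior slope the rescaled action is eventually within `ε` of a constant, which
does not depend on the configuration, and serves a neighbourhood of the slope. -/
lemma exists_eventually_near {l : ℕ → ℤ → ℝ} (hc : 0 < c) {α₀ : ℝ} (hα₀ : |α₀| < 1) {ε : ℝ}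
    (hε : 0 < ε) :
    ∃ x : ℝ, ∃ η > 0, ∀ α : ℝ, |α - α₀| < η → |α| ≤ 1 → ∀ ω ∈ limitConf c l,
      ∀ᶠ n : ℕ in atTop, |confAction n (roundToZero (α * n)) ω / n - x| ≤ ε := by
  obtain ⟨δ, hδ0, hδ1, hδ⟩ : ∃ δ : ℝ, 0 < δ ∧ δ < 1 ∧ 3 * (c * δ) ≤ ε := by
    refine ⟨min (1 / 2) (ε / (3 * c)), by positivity,
      (min_le_left _ _).trans_lt (by norm_num), ?_⟩
    have := min_le_right (1 / 2) (ε / (3 * c))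
    rw [le_div_iff₀ (by positivity)] at this
    linarith
  set r := (1 + |α₀|) / 2 with hr
  have hr1 : r < 1 := by rw [hr]; linarith
  have hr0 : 0 ≤ r := by positivity
  -- Reaching the lattice point leaves slack `(1 - r) * δ * n`. Two slope errors of `η * n` take
  -- half of it and rounding the other half.
  set η := min (δ * (1 - r) / 4) ((1 - |α₀|) / 2) with hη
  have hη0 : 0 < η := lt_min (by have := sub_pos.2 hr1; positivity) (by linarith)
  have hη1 : η ≤ δ * (1 - r) / 4 := min_le_left _ _
  have hη2 : η ≤ (1 - |α₀|) / 2 := min_le_right _ _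
  -- The approximating slope must be nonzero for its limit to be available, also when `α₀ = 0`.
  obtain ⟨β, hβ, hβ0⟩ : ∃ β : ℚ, |(β : ℝ) - α₀| < η ∧ β ≠ 0 := by
    rcases le_or_gt 0 α₀ with h | h
    · obtain ⟨β, h1, h2⟩ := exists_rat_btwn (show α₀ < α₀ + η by linarith)
      refine ⟨β, by rw [abs_lt]; constructor <;> linarith, ?_⟩
      rintro rfl
      simp only [Rat.cast_zero] at h1
      linarith
    · obtain ⟨β, h1, h2⟩ := exists_rat_btwn (show α₀ - η < α₀ by linarith)
      refine ⟨β, by rw [abs_lt]; constructor <;> linarith, ?_⟩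
      rintro rfl
      simp only [Rat.cast_zero] at h2
      linarith
  set q := β.den with hq
  set p := β.num with hp
  have hq0 : q ≠ 0 := β.den_nz
  have hqr : (0 : ℝ) < q := by positivity
  have hp0 : p ≠ 0 := Rat.num_ne_zero.2 hβ0
  have hβpq : (p : ℝ) = β * q := by
    rw [Rat.cast_def, ← hp, ← hq]; field_simp
  have hβr : |(β : ℝ)| ≤ r := by
    have h1 : |(β : ℝ)| ≤ |(β : ℝ) - α₀| + |α₀| := by
      simpa using abs_add_le ((β : ℝ) - α₀) α₀
    rw [hr]; linarith
  have hpq : |p| ≤ q := by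
    have : |(p : ℝ)| ≤ q := by
      rw [hβpq, abs_mul, Nat.abs_cast]
      exact mul_le_of_le_one_left hqr.le (hβr.trans hr1.le)
    exact_mod_cast this
  have hmp : ∀ m : ℕ, |(m : ℤ) * p| ≤ (m * q : ℕ) := fun m => by
    rw [abs_mul, abs_of_nonneg (by positivity : (0 : ℤ) ≤ m)]
    push_cast
    gcongr
  refine ⟨l q p / q, η, hη0, fun α hα hα1 ω hω => ?_⟩
  have hlim := hω.2 q p hq0 hp0 hpq
  have hlq : |l q p| ≤ c * q := by
    refine le_of_tendsto hlim.abs ?_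
    filter_upwards [eventually_gt_atTop 0] with n hn
    have hn' : (0 : ℝ) < n := by exact_mod_cast hn
    rw [abs_div, Nat.abs_cast, div_le_iff₀ hn']
    refine (abs_confAction_le hω.1 (hmp n)).trans_eq ?_
    push_cast; ring
  have hlq' : |l q p / q| ≤ c := by
    rw [abs_div, Nat.abs_cast, div_le_iff₀ hqr]; exact hlq
  -- the geometric condition, for times `N` that differ from `n` by at least `δ * n`
  have hgeo : ∀ᶠ n : ℕ in atTop, ∀ m : ℕ, δ * n ≤ |(m * q : ℝ) - n| →
      |(((m : ℤ) * p - roundToZero (α * n) : ℤ) : ℝ)| ≤ |(m * q : ℝ) - n| := by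
    have hlarge : ∀ᶠ n : ℕ in atTop, 1 ≤ (1 - r) * δ / 2 * n :=
      (tendsto_natCast_atTop_atTop.const_mul_atTop (by
        have := sub_pos.2 hr1; positivity)).eventually_ge_atTop 1
    filter_upwards [hlarge] with n hn m hm
    have e : (((m : ℤ) * p - roundToZero (α * n) : ℤ) : ℝ) =
        β * (m * q - n) + ((β - α₀) * n + (α₀ - α) * n + (α * n - roundToZero (α * n))) := by
      push_cast
      rw [hβpq]; ring
    rw [e]
    have hn0 : (0 : ℝ) ≤ n := Nat.cast_nonneg n
    have h1 : |(β : ℝ) * (m * q - n)| ≤ r * |(m * q : ℝ) - n| := by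
      rw [abs_mul]; gcongr
    have h2 : |((β : ℝ) - α₀) * n| ≤ η * n := by
      rw [abs_mul, Nat.abs_cast]; gcongr
    have h3 : |(α₀ - α) * n| ≤ η * n := by
      rw [abs_mul, Nat.abs_cast, abs_sub_comm]; gcongr
    have h4 : |α * n - roundToZero (α * n)| ≤ 1 := by
      rw [abs_sub_comm]; exact abs_roundToZero_sub_le _
    have h5 := abs_add_le ((β : ℝ) * (m * q - n))
      ((β - α₀) * n + (α₀ - α) * n + (α * n - roundToZero (α * n)))
    have h6 := abs_add_le (((β : ℝ) - α₀) * n + (α₀ - α) * n) (α * n - roundToZero (α * n))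
    have h7 := abs_add_le (((β : ℝ) - α₀) * n) ((α₀ - α) * n)
    have h8 : η * n ≤ δ * (1 - r) / 4 * n := by gcongr
    have h9 : (1 - r) * (δ * n) ≤ (1 - r) * |(m * q : ℝ) - n| :=
      mul_le_mul_of_nonneg_left hm (by linarith)
    nlinarith
  -- The lattice vector `(q, p)` is taken `m₁` times, to reach a time just after `(1 + δ) * n`, and
  -- `m₂` times, to stop just before `(1 - δ) * n`. Prolonging walks on both sides sandwiches the
  -- action; each limit is off by at most `2 * (c * δ) < ε`.
  set a₁ := (1 + δ) / q with ha₁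
  set a₂ := (1 - δ) / q with ha₂
  have ha₁0 : 0 < a₁ := by positivity
  have ha₂0 : 0 < a₂ := div_pos (by linarith) hqr
  set m₁ : ℕ → ℕ := fun n => ⌈a₁ * (n : ℝ)⌉₊ with hm₁
  set m₂ : ℕ → ℕ := fun n => ⌊a₂ * (n : ℝ)⌋₊ with hm₂
  have hm₁t : Tendsto m₁ atTop atTop :=
    tendsto_nat_ceil_atTop.comp (tendsto_natCast_atTop_atTop.const_mul_atTop ha₁0)
  have hm₂t : Tendsto m₂ atTop atTop :=
    tendsto_nat_floor_atTop.comp (tendsto_natCast_atTop_atTop.const_mul_atTop ha₂0)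
  have hm₁a : Tendsto (fun n => (m₁ n : ℝ) / n) atTop (𝓝 a₁) :=
    (tendsto_nat_ceil_mul_div_atTop ha₁0.le).comp tendsto_natCast_atTop_atTop
  have hm₂a : Tendsto (fun n => (m₂ n : ℝ) / n) atTop (𝓝 a₂) :=
    (tendsto_nat_floor_mul_div_atTop ha₂0.le).comp tendsto_natCast_atTop_atTop
  have hA₁ := tendsto_confAction_div hlim hm₁t hm₁a
  have hA₂ := tendsto_confAction_div hlim hm₂t hm₂a
  have hL : Tendsto (fun n : ℕ => confAction (m₁ n * q) (m₁ n * p) ω / n -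
      c * ((m₁ n : ℝ) / n * q - 1)) atTop (𝓝 (l q p * a₁ - c * (a₁ * q - 1))) :=
    hA₁.sub (((hm₁a.mul_const _).sub_const _).const_mul _)
  have hU : Tendsto (fun n : ℕ => confAction (m₂ n * q) (m₂ n * p) ω / n +
      c * (1 - (m₂ n : ℝ) / n * q)) atTop (𝓝 (l q p * a₂ + c * (1 - a₂ * q))) :=
    hA₂.add (((hm₂a.mul_const _).const_sub _).const_mul _)
  have hxδ : |l q p / q * δ| ≤ c * δ := by
    rw [abs_mul, abs_of_pos hδ0]; gcongr
  have hxδ' := abs_le.1 hxδ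
  have eL : l q p * a₁ - c * (a₁ * q - 1) = l q p / q + l q p / q * δ - c * δ := by
    rw [ha₁]; field_simp; ring
  have eU : l q p * a₂ + c * (1 - a₂ * q) = l q p / q - l q p / q * δ + c * δ := by
    rw [ha₂]; field_simp; ring
  rw [eL] at hL
  rw [eU] at hU
  have hcδ : 0 < c * δ := by positivity
  filter_upwards [hgeo, hL.eventually_const_lt (show l q p / q - ε <
      l q p / q + l q p / q * δ - c * δ by linarith),
    hU.eventually_lt_const (show l q p / q - l q p / q * δ + c * δ < l q p / q + ε by linarith),
    eventually_gt_atTop 0] with n hn hnL hnU hn0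
  have hn0' : (0 : ℝ) < n := by exact_mod_cast hn0
  have hk : |roundToZero (α * n)| ≤ n := abs_roundToZero_mul_le (abs_le.1 hα1) n
  have h1 : (1 + δ) * n ≤ m₁ n * q := by
    have := Nat.le_ceil (a₁ * (n : ℝ))
    calc (1 + δ) * n = a₁ * n * q := by rw [ha₁]; field_simp
      _ ≤ m₁ n * q := by gcongr
  have h2 : m₂ n * q ≤ (1 - δ) * n := by
    have := Nat.floor_le (show 0 ≤ a₂ * (n : ℝ) by positivity)
    calc (m₂ n * q : ℝ) ≤ a₂ * n * q := by gcongr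
      _ = (1 - δ) * n := by rw [ha₂]; field_simp
  have hδn : 0 < δ * n := by positivity
  have hlow : confAction (m₁ n * q) (m₁ n * p) ω ≤
      confAction n (roundToZero (α * n)) ω + c * ((m₁ n * q : ℕ) - n) := by
    refine confAction_extend hω.1 hk ?_ ?_
    · have : (n : ℝ) ≤ (m₁ n * q : ℕ) := by push_cast; linarith
      exact_mod_cast this
    · have h3 := hn (m₁ n) (by rw [abs_of_nonneg (by linarith)]; linarith)
      rw [abs_of_nonneg (show (0 : ℝ) ≤ m₁ n * q - n by linarith)] at h3
      exact_mod_cast h3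
  have hup : confAction n (roundToZero (α * n)) ω ≤
      confAction (m₂ n * q) (m₂ n * p) ω + c * (n - (m₂ n * q : ℕ)) := by
    refine confAction_extend hω.1 (hmp _) ?_ ?_
    · have : ((m₂ n * q : ℕ) : ℝ) ≤ n := by push_cast; linarith
      exact_mod_cast this
    · have h3 := hn (m₂ n) (by rw [abs_of_nonpos (by linarith)]; linarith)
      rw [abs_of_nonpos (show (m₂ n * q : ℝ) - n ≤ 0 by linarith), neg_sub] at h3
      rw [abs_sub_comm]
      exact_mod_cast h3
  push_cast at hlow hup
  have hlow' : confAction (m₁ n * q) (m₁ n * p) ω / n - c * ((m₁ n : ℝ) / n * q - 1) ≤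
      confAction n (roundToZero (α * n)) ω / n := by
    rw [le_div_iff₀ hn0', sub_mul, div_mul_cancel₀ _ hn0'.ne']
    have : c * ((m₁ n : ℝ) / n * q - 1) * n = c * (m₁ n * q - n) := by field_simp
    linarith
  have hup' : confAction n (roundToZero (α * n)) ω / n ≤
      confAction (m₂ n * q) (m₂ n * p) ω / n + c * (1 - (m₂ n : ℝ) / n * q) := by
    rw [div_le_iff₀ hn0', add_mul, div_mul_cancel₀ _ hn0'.ne']
    have : c * (1 - (m₂ n : ℝ) / n * q) * n = c * (n - m₂ n * q) := by field_simp
    linarith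
  rw [abs_le]
  constructor <;> linarith

/-- The existence of the shape function, without its properties. -/
lemma exists_shape {l : ℕ → ℤ → ℝ} (hc : 0 < c) :
    ∃ Λ : ℝ → ℝ, ∀ α ∈ Icc (-1 : ℝ) 1, ∀ ω ∈ limitConf c l,
      Tendsto (fun n : ℕ => confAction n (roundToZero (α * n)) ω / n) atTop (𝓝 (-Λ α)) := by
  have h : ∀ α : ℝ, ∃ y : ℝ, α ∈ Icc (-1 : ℝ) 1 → ∀ ω ∈ limitConf c l,
      Tendsto (fun n : ℕ => confAction n (roundToZero (α * n)) ω / n) atTop (𝓝 (-y)) := by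
    intro α
    rcases lt_trichotomy |α| 1 with h | h | h
    · obtain ⟨y, hy⟩ := exists_common_limit (limitConf c l)
        (fun ω n => confAction n (roundToZero (α * n)) ω / n) fun ε hε => by
          obtain ⟨x, η, hη, hx⟩ := exists_eventually_near (l := l) hc h hε
          exact ⟨x, hx α (by simpa using hη) h.le⟩
      exact ⟨-y, fun _ => by simpa using hy⟩
    -- On the boundary of the cone a walk cannot be rerouted, but here the slope is an integer and
    -- its limit is one of those given by `limitConf`.
    · obtain ⟨p, hp, rfl⟩ : ∃ p : ℤ, |p| = 1 ∧ (p : ℝ) = α := by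
        rcases abs_cases α with ⟨h1, -⟩ | ⟨h1, -⟩
        · exact ⟨1, by simp, by simp; linarith⟩
        · exact ⟨-1, by simp, by simp; linarith⟩
      refine ⟨-l 1 p, fun _ ω hω => ?_⟩
      rw [neg_neg]
      refine (hω.2 1 p one_ne_zero (by rintro rfl; simp at hp) (by simp [hp])).congr fun n => ?_
      have : (p : ℝ) * n = ((n * p : ℤ) : ℝ) := by push_cast; ring
      rw [this, roundToZero_intCast, mul_one]
    · exact ⟨0, fun hα => absurd (abs_le.2 hα) (not_le.2 h)⟩
  choose Λ hΛ using h
  exact ⟨Λ, hΛ⟩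

end Limit

/-! ### Properties of the shape function. -/

section Shape

variable {c : ℝ} {ν : Measure ℝ} [IsProbabilityMeasure ν]

/-- `Λ` gives the almost sure limits in the canonical environment. -/
def IsLimitShape (ν : Measure ℝ) (Λ : ℝ → ℝ) : Prop :=
  ∀ α ∈ Icc (-1 : ℝ) 1, ∀ᵐ ω ∂envLaw ν,
    Tendsto (fun n : ℕ => confAction n (roundToZero (α * n)) ω / n) atTop (𝓝 (-Λ α))

/-- In `exists_eventually_near` the same constant serves a whole neighbourhood of `α₀`, so the
limits there are close to each other. -/
lemma continuousAt_shape (hc : 0 < c) {l : ℕ → ℤ → ℝ} {Λ : ℝ → ℝ}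
    (hl : ∀ᵐ ω ∂envLaw ν, ω ∈ limitConf c l)
    (hΛ : ∀ α ∈ Icc (-1 : ℝ) 1, ∀ ω ∈ limitConf c l,
      Tendsto (fun n : ℕ => confAction n (roundToZero (α * n)) ω / n) atTop (𝓝 (-Λ α)))
    {α₀ : ℝ} (hα₀ : |α₀| < 1) : ContinuousAt Λ α₀ := by
  obtain ⟨ω, hω⟩ := hl.exists
  rw [Metric.continuousAt_iff]
  intro ε hε
  obtain ⟨x, η, hη, hx⟩ := exists_eventually_near (l := l) hc hα₀ (show 0 < ε / 3 by positivity)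
  have key : ∀ α, |α - α₀| < η → |α| ≤ 1 → |-Λ α - x| ≤ ε / 3 := fun α h1 h2 =>
    le_of_tendsto ((hΛ α (abs_le.1 h2) ω hω).sub_const x).abs (hx α h1 h2 ω hω)
  refine ⟨min η (1 - |α₀|), lt_min hη (by linarith), fun {α} hα => ?_⟩
  rw [Real.dist_eq] at hα
  have h1 : |α| ≤ 1 := by
    have := abs_add_le (α - α₀) α₀
    rw [sub_add_cancel] at this
    linarith [min_le_right η (1 - |α₀|)]
  have h2 := abs_le.1 (key α (hα.trans_le (min_le_left _ _)) h1)
  have h3 := abs_le.1 (key α₀ (by simpa using hη) hα₀.le)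
  rw [Real.dist_eq, abs_lt]
  constructor <;> linarith

variable {Λ : ℝ → ℝ}

lemma tendsto_meanAction (hν : IsSiteLaw c ν) (h : IsLimitShape ν Λ) {α : ℝ}
    (hα : α ∈ Icc (-1 : ℝ) 1) :
    Tendsto (fun n : ℕ => meanAction ν n (roundToZero (α * n)) / n) atTop (𝓝 (-Λ α)) := by
  have h1 := tendsto_integral_of_dominated_convergence (μ := envLaw ν) (fun _ => c)
    (F := fun (n : ℕ) ω => confAction n (roundToZero (α * n)) ω / n) (f := fun _ => -Λ α)
    (fun n => ((measurable_confAction n _).div_const _).aestronglyMeasurable)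
    (integrable_const c) (fun n => ?_) (h α hα)
  · simpa [integral_div, meanAction] using h1
  · filter_upwards [ae_goodConf hν] with ω hω
    have hc0 : 0 ≤ c := (abs_nonneg _).trans (hω.2 0)
    rw [norm_div, Real.norm_eq_abs, Real.norm_natCast]
    exact div_le_of_le_mul₀ (Nat.cast_nonneg n) hc0
      (abs_confAction_le hω (abs_roundToZero_mul_le hα n))

lemma div_mem_Icc {q : ℕ} {p : ℤ} (hpq : |p| ≤ q) : (p / q : ℝ) ∈ Icc (-1 : ℝ) 1 := by
  rw [mem_Icc, ← abs_le, abs_div, Nat.abs_cast]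
  have : |(p : ℝ)| ≤ q := by exact_mod_cast hpq
  exact div_le_one_of_le₀ this (Nat.cast_nonneg q)

lemma tendsto_meanAction_mul (hν : IsSiteLaw c ν) (h : IsLimitShape ν Λ) {q : ℕ} {p : ℤ}
    (hq : q ≠ 0) (hpq : |p| ≤ q) :
    Tendsto (fun n : ℕ => meanAction ν (n * q) (n * p) / n) atTop (𝓝 (-(q * Λ (p / q)))) := by
  have hqr : (q : ℝ) ≠ 0 := by exact_mod_cast hq
  have h1 := ((tendsto_meanAction hν h (div_mem_Icc hpq)).comp
    (tendsto_id.atTop_mul_const' (Nat.pos_of_ne_zero hq))).mul_const (q : ℝ)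
  rw [show -Λ (p / q) * q = -(q * Λ (p / q)) by ring] at h1
  refine h1.congr fun n => ?_
  have e : (p / q : ℝ) * ((n * q : ℕ) : ℝ) = ((n * p : ℤ) : ℝ) := by
    push_cast; field_simp
  simp only [Function.comp, id]
  rw [e, roundToZero_intCast]
  push_cast
  field_simp

/-- The shape function in its homogeneous form is superadditive. -/
lemma shape_superadditive (hν : IsSiteLaw c ν) (h : IsLimitShape ν Λ) {q₁ q₂ : ℕ} {p₁ p₂ : ℤ}
    (hq₁ : q₁ ≠ 0) (hq₂ : q₂ ≠ 0) (h₁ : |p₁| ≤ q₁) (h₂ : |p₂| ≤ q₂) :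
    q₁ * Λ (p₁ / q₁) + q₂ * Λ (p₂ / q₂) ≤ (q₁ + q₂) * Λ ((p₁ + p₂) / (q₁ + q₂)) := by
  have h12 : |p₁ + p₂| ≤ (q₁ + q₂ : ℕ) := by
    push_cast; exact (abs_add_le _ _).trans (add_le_add h₁ h₂)
  have hnp : ∀ (q : ℕ) (p : ℤ), |p| ≤ q → ∀ n : ℕ, |(n : ℤ) * p| ≤ (n * q : ℕ) :=
    fun q p hpq n => by
      rw [abs_mul, abs_of_nonneg (by positivity : (0 : ℤ) ≤ n)]
      push_cast
      gcongr
  have l1 := (tendsto_meanAction_mul hν h hq₁ h₁).add (tendsto_meanAction_mul hν h hq₂ h₂)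
  have l2 := tendsto_meanAction_mul hν h (by omega : q₁ + q₂ ≠ 0) h12
  have l3 := le_of_tendsto_of_tendsto' l2 l1 fun n => by
    rw [← add_div]
    gcongr
    have := meanAction_add_le hν (hnp q₁ p₁ h₁ n) (hnp q₂ p₂ h₂ n)
    rwa [mul_add, mul_add]
  push_cast at l3
  linarith

/-- By subadditivity the limit of the means along multiples lies below each single term. A gain in
mean at one finite point thus becomes a bound on `Λ`. -/
lemma neg_meanAction_le_shape (hν : IsSiteLaw c ν) (h : IsLimitShape ν Λ) {q : ℕ} {p : ℤ}
    (hq : q ≠ 0) (hpq : |p| ≤ q) : -meanAction ν q p ≤ q * Λ (p / q) := by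
  have h1 := le_of_tendsto (tendsto_meanAction_mul hν h hq hpq)
    (b := meanAction ν q p) (by
      filter_upwards [eventually_gt_atTop 0] with n hn
      have hn' : (0 : ℝ) < n := by exact_mod_cast hn
      rw [div_le_iff₀ hn', mul_comm (meanAction ν q p)]
      exact meanAction_mul_le hν hpq n)
  linarith

lemma shape_neg (hν : IsSiteLaw c ν) (h : IsLimitShape ν Λ) {α : ℝ}
    (hα : α ∈ Icc (-1 : ℝ) 1) : Λ (-α) = Λ α := by
  have hα' : -α ∈ Icc (-1 : ℝ) 1 := ⟨by linarith [hα.2], by linarith [hα.1]⟩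
  have h1 := tendsto_meanAction hν h hα'
  simp only [neg_mul, roundToZero_neg, meanAction_neg (abs_roundToZero_mul_le hα _)] at h1
  exact neg_injective (tendsto_nhds_unique h1 (tendsto_meanAction hν h hα))

lemma shape_one (hν : IsSiteLaw c ν) (h : IsLimitShape ν Λ) : Λ 1 = 0 := by
  have h1 := tendsto_meanAction_mul hν h (q := 1) (p := 1) one_ne_zero (by simp)
  simp only [mul_one, meanAction_diagonal hν, zero_div] at h1
  simpa using (tendsto_nhds_unique h1 tendsto_const_nhds)

lemma shape_le (hν : IsSiteLaw c ν) (h : IsLimitShape ν Λ) {α : ℝ}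
    (hα : α ∈ Icc (-1 : ℝ) 1) : Λ α ≤ c - siteGap c ν * |α| := by
  wlog h0 : 0 ≤ α generalizing α
  · have := this (α := -α) ⟨by linarith [hα.2], by linarith [hα.1]⟩ (by linarith)
    rwa [shape_neg hν h hα, abs_neg] at this
  rw [abs_of_nonneg h0]
  have h1 : Tendsto (fun n : ℕ => -c + siteGap c ν * ((roundToZero (α * n) : ℝ) / n)) atTop
      (𝓝 (-c + siteGap c ν * α)) :=
    ((tendsto_roundToZero_div α tendsto_id).const_mul _).const_add _
  have h2 := le_of_tendsto_of_tendsto h1 (tendsto_meanAction hν h hα) (by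
    filter_upwards [eventually_gt_atTop 0] with n hn
    have hn' : (0 : ℝ) < n := by exact_mod_cast hn
    rw [le_div_iff₀ hn']
    have := le_meanAction hν (abs_roundToZero_mul_le hα n) (roundToZero_nonneg (by positivity))
    have e : (-c + siteGap c ν * ((roundToZero (α * n) : ℝ) / n)) * n =
        -c * n + siteGap c ν * roundToZero (α * n) := by field_simp
    linarith)
  linarith

/-- The linear upper bound gives `Λ 0 ≤ c`; the converse comes from dwelling on two sites with
potentials near `c` and `-c`. -/
lemma shape_zero (hν : IsSiteLaw c ν) (h : IsLimitShape ν Λ) : Λ 0 = c := by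
  refine le_antisymm (by simpa using shape_le hν h (α := 0) (by simp)) ?_
  refine le_of_forall_lt fun d hd => ?_
  obtain ⟨d', hd1, hd2⟩ := exists_between hd
  refine hd1.trans_le ?_
  -- The limit is deterministic, so it may be read off from one configuration in an event of merely
  -- positive probability.
  obtain ⟨ω, hω, h1, h2⟩ : ∃ ω ∈ {ω : ℤ ⊕ ℤ → ℝ | d' < ω (.inr 0) ∧ ω (.inr 1) < -d'},
      ω ∈ goodConf c ∧ Tendsto (fun n : ℕ => confAction n (roundToZero (0 * n)) ω / n) atTop
        (𝓝 (-Λ 0)) := by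
    by_contra! hcon
    refine (measure_pair_pos hν hd2).ne' (measure_mono_null (fun ω hω => ?_)
      (ae_iff.1 ((ae_goodConf hν).and (h 0 (by simp)))))
    exact fun hw => hcon ω hω hw.1 hw.2
  have h3 : ∀ n : ℕ, confAction (n + 1) (roundToZero (0 * (n + 1 : ℕ))) ω / ((n + 1 : ℕ) : ℝ) ≤
      -d' + (c + d') / ((n + 1 : ℕ) : ℝ) := by
    intro n
    have e : roundToZero (0 * (n + 1 : ℕ)) = 0 := by
      simpa using roundToZero_intCast 0
    rw [e, div_le_iff₀ (by positivity), add_mul, div_mul_cancel₀ _ (by positivity)]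
    have := minAction_dwell_le h1.1 h1.2 hω.1.le hω.2.le n
    change confAction (n + 1) 0 ω ≤ _ at this
    push_cast
    linarith
  have h4 : Tendsto (fun n : ℕ => -d' + (c + d') / ((n + 1 : ℕ) : ℝ)) atTop (𝓝 (-d' + 0)) :=
    ((tendsto_const_div_atTop_nhds_zero_nat (c + d')).comp (tendsto_add_atTop_nat 1)).const_add _
  have h5 := le_of_tendsto_of_tendsto' (h2.comp (tendsto_add_atTop_nat 1)) h4 h3
  linarith

/-- The upper bound that controls the shape function near the slope `1`. -/
lemma shape_le_entropy (hν : IsSiteLaw c ν) (hc : 0 < c) (h : IsLimitShape ν Λ) {α : ℝ}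
    (hα : α ∈ Icc (-1 : ℝ) 1) {t : ℝ} (ht : 0 < t) {θ : ℝ} (hθ : 0 ≤ θ) :
    Λ α ≤ (θ * (1 - α) + ((t * c) ^ 2 / 2 + 2 * Real.exp (-θ))) / t := by
  have h1 : Tendsto (fun n : ℕ => (θ * (1 - (roundToZero (α * n) : ℝ) / n) +
      ((t * c) ^ 2 / 2 + 2 * Real.exp (-θ))) / t) atTop
      (𝓝 ((θ * (1 - α) + ((t * c) ^ 2 / 2 + 2 * Real.exp (-θ))) / t)) :=
    ((((tendsto_roundToZero_div α tendsto_id).const_sub 1).const_mul θ).add_const _).div_const t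
  have h2 := (tendsto_meanAction hν h hα).neg
  rw [neg_neg] at h2
  refine le_of_tendsto_of_tendsto h2 h1 ?_
  filter_upwards [eventually_gt_atTop 0] with n hn
  have hn' : (0 : ℝ) < n := by exact_mod_cast hn
  have h3 := neg_meanAction_le hν hc ht hθ (abs_roundToZero_mul_le hα n)
  rw [← neg_div, div_le_iff₀ hn']
  refine h3.trans_eq ?_
  field_simp

/-- Superadditivity with a part of slope `1` and a part of slope `0`, at rational slopes first.
Concavity on the closed interval cannot be used yet, because continuity at `1` rests on the
nonnegativity obtained here. -/
lemma le_shape (hν : IsSiteLaw c ν) (h : IsLimitShape ν Λ)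
    (hcont : ∀ α : ℝ, |α| < 1 → ContinuousAt Λ α) {α : ℝ} (hα : α ∈ Icc (-1 : ℝ) 1) :
    c * (1 - |α|) ≤ Λ α := by
  wlog h0 : 0 ≤ α generalizing α
  · have := this (α := -α) ⟨by linarith [hα.2], by linarith [hα.1]⟩ (by linarith)
    rwa [shape_neg hν h hα, abs_neg] at this
  rw [abs_of_nonneg h0]
  rcases hα.2.eq_or_lt with rfl | h1
  · simp [shape_one hν h]
  have hpq : ∀ p q : ℕ, p ≠ 0 → p < q → c * (1 - p / q) ≤ Λ (p / q) := by
    intro p q hp hq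
    have hsup := shape_superadditive hν h (q₁ := p) (q₂ := q - p) (p₁ := p) (p₂ := 0) hp
      (by omega) (by simp) (by simp)
    have hp0 : (p : ℝ) ≠ 0 := by exact_mod_cast hp
    have hq0 : (0 : ℝ) < q := by exact_mod_cast (Nat.zero_le p).trans_lt hq
    have e : ((q - p : ℕ) : ℝ) = q - p := by rw [Nat.cast_sub hq.le]
    rw [e] at hsup
    simp only [Int.cast_natCast, div_self hp0, shape_one hν h, Int.cast_zero, zero_div,
      shape_zero hν h, mul_zero, zero_add, add_zero, add_sub_cancel] at hsup
    have e2 : c * (1 - p / q) = (q - p) * c / q := by field_simp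
    rw [e2, div_le_iff₀ hq0]
    linarith
  have hq : Tendsto (fun n : ℕ => n + 1) atTop atTop := tendsto_add_atTop_nat 1
  set p : ℕ → ℕ := fun n => ⌊α * ((n + 1 : ℕ) : ℝ)⌋₊ with hp
  rcases h0.eq_or_lt with rfl | h0'
  · simp [shape_zero hν h]
  have hlim : Tendsto (fun n : ℕ => (p n : ℝ) / ((n + 1 : ℕ) : ℝ)) atTop (𝓝 α) :=
    (tendsto_nat_floor_mul_div_atTop h0).comp (tendsto_natCast_atTop_atTop.comp hq)
  have hpt : Tendsto p atTop atTop := tendsto_nat_floor_atTop.comp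
    ((tendsto_natCast_atTop_atTop.comp hq).const_mul_atTop h0')
  refine le_of_tendsto_of_tendsto ((hlim.const_sub 1).const_mul c)
    ((hcont α (by rwa [abs_of_nonneg h0])).tendsto.comp hlim) ?_
  filter_upwards [hpt.eventually_gt_atTop 0] with n hn
  refine hpq _ _ hn.ne' ?_
  have h2 : (p n : ℝ) ≤ α * ((n + 1 : ℕ) : ℝ) := Nat.floor_le (by positivity)
  have h3 : α * ((n + 1 : ℕ) : ℝ) < 1 * ((n + 1 : ℕ) : ℝ) := by gcongr
  have h4 : (p n : ℝ) < ((n + 1 : ℕ) : ℝ) := by linarith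
  exact_mod_cast h4

lemma shape_nonneg (hν : IsSiteLaw c ν) (hc : 0 < c) (h : IsLimitShape ν Λ)
    (hcont : ∀ α : ℝ, |α| < 1 → ContinuousAt Λ α) {α : ℝ} (hα : α ∈ Icc (-1 : ℝ) 1) :
    0 ≤ Λ α :=
  (mul_nonneg hc.le (sub_nonneg.2 (abs_le.2 hα))).trans (le_shape hν h hcont hα)

lemma continuousWithinAt_shape_one (hν : IsSiteLaw c ν) (hc : 0 < c) (h : IsLimitShape ν Λ)
    (hcont : ∀ α : ℝ, |α| < 1 → ContinuousAt Λ α) :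
    ContinuousWithinAt Λ (Icc (-1) 1) 1 := by
  rw [Metric.continuousWithinAt_iff]
  intro ε hε
  -- The quadratic term of `shape_le_entropy` becomes exactly `t * ε / 4`. Next `θ`, and then the
  -- radius, are chosen to keep each of the other two terms below the same value.
  set t := ε / (2 * c ^ 2) with ht
  have ht0 : 0 < t := by positivity
  have hexp : Tendsto (fun θ : ℝ => 2 * Real.exp (-θ)) atTop (𝓝 (2 * 0)) :=
    (Real.tendsto_exp_neg_atTop_nhds_zero).const_mul 2
  rw [mul_zero] at hexp
  obtain ⟨θ, hθ, hθ0⟩ := ((hexp.eventually_lt_const (show 0 < t * ε / 4 by positivity)).and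
    (eventually_gt_atTop 0)).exists
  refine ⟨t * ε / 4 / θ, by positivity, fun {α} hα hd => ?_⟩
  rw [Real.dist_eq, abs_lt] at hd
  have h1 := shape_le_entropy hν hc h hα ht0 hθ0.le
  have h2 := shape_nonneg hν hc h hcont hα
  rw [shape_one hν h, Real.dist_eq, sub_zero, abs_of_nonneg h2]
  refine h1.trans_lt ?_
  rw [div_lt_iff₀ ht0]
  have h3 : θ * (1 - α) < t * ε / 4 := by
    have := hd.1
    have h4 : 1 - α < t * ε / 4 / θ := by linarith
    rw [lt_div_iff₀ hθ0] at h4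
    linarith
  have h5 : (t * c) ^ 2 / 2 = t * ε / 4 := by
    rw [ht]; field_simp; ring
  nlinarith [mul_pos ht0 hε]

lemma continuousOn_shape (hν : IsSiteLaw c ν) (hc : 0 < c) (h : IsLimitShape ν Λ)
    (hcont : ∀ α : ℝ, |α| < 1 → ContinuousAt Λ α) : ContinuousOn Λ (Icc (-1) 1) := by
  intro α hα
  have h1 := continuousWithinAt_shape_one hν hc h hcont
  rcases (abs_le.2 hα).lt_or_eq with hlt | heq
  · exact (hcont α hlt).continuousWithinAt
  rcases (abs_eq zero_le_one).1 heq with rfl | rfl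
  · exact h1
  · have hmaps : MapsTo (fun x : ℝ => -x) (Icc (-1) 1) (Icc (-1) 1) :=
      fun x hx => ⟨by linarith [hx.2], by linarith [hx.1]⟩
    have h2 : ContinuousWithinAt (fun x => Λ (-x)) (Icc (-1) 1) (-1) :=
      ContinuousWithinAt.comp (g := Λ) (f := fun x : ℝ => -x) (t := Icc (-1) 1)
        (by rwa [neg_neg]) continuous_neg.continuousWithinAt hmaps
    exact h2.congr (fun x hx => (shape_neg hν h hx).symm) (shape_neg hν h (by simp)).symm

lemma concaveOn_shape (hν : IsSiteLaw c ν) (hc : 0 < c) (h : IsLimitShape ν Λ)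
    (hcont : ∀ α : ℝ, |α| < 1 → ContinuousAt Λ α) : ConcaveOn ℝ (Icc (-1) 1) Λ := by
  have hco := continuousOn_shape hν hc h hcont
  rw [concaveOn_iff_forall_pos]
  refine ⟨convex_Icc _ _, fun x hx y hy a b ha hb hab => ?_⟩
  have hz : a * x + b * y ∈ Icc (-1 : ℝ) 1 :=
    (convex_Icc (-1 : ℝ) 1) hx hy ha.le hb.le hab
  -- Superadditivity is known for integer vectors only. Lengths close to `a * n` and `b * n` with
  -- rounded endpoints have slopes tending to `x` and `y`, and continuity on the closed interval
  -- passes to the limit even at the ends.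
  set q : ℝ → ℕ → ℕ := fun a n => ⌈a * (n : ℝ)⌉₊ with hq
  set p : ℝ → ℝ → ℕ → ℤ := fun a x n => roundToZero (x * q a n) with hp
  have hqt : ∀ a : ℝ, 0 < a → Tendsto (q a) atTop atTop := fun a ha =>
    tendsto_nat_ceil_atTop.comp (tendsto_natCast_atTop_atTop.const_mul_atTop ha)
  have hqa : ∀ a : ℝ, 0 < a → Tendsto (fun n => (q a n : ℝ) / n) atTop (𝓝 a) := fun a ha =>
    (tendsto_nat_ceil_mul_div_atTop ha.le).comp tendsto_natCast_atTop_atTop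
  have hpq : ∀ a x : ℝ, 0 < a → Tendsto (fun n => (p a x n : ℝ) / q a n) atTop (𝓝 x) :=
    fun a x ha => tendsto_roundToZero_div x (hqt a ha)
  have hpa : ∀ a x : ℝ, 0 < a → Tendsto (fun n => (p a x n : ℝ) / n) atTop (𝓝 (x * a)) := by
    intro a x ha
    refine ((hpq a x ha).mul (hqa a ha)).congr' ?_
    filter_upwards [(hqt a ha).eventually_gt_atTop 0] with n hn
    have : (q a n : ℝ) ≠ 0 := by positivity
    field_simp
  have hple : ∀ a x : ℝ, x ∈ Icc (-1 : ℝ) 1 → ∀ n, |p a x n| ≤ q a n := fun a x hx n =>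
    abs_roundToZero_mul_le hx _
  have hΛ : ∀ a x : ℝ, 0 < a → x ∈ Icc (-1 : ℝ) 1 →
      Tendsto (fun n => Λ (p a x n / q a n)) atTop (𝓝 (Λ x)) := fun a x ha hx =>
    (hco x hx).tendsto.comp (tendsto_nhdsWithin_iff.2
      ⟨hpq a x ha, Eventually.of_forall fun n => div_mem_Icc (hple a x hx n)⟩)
  have hle12 : ∀ n, |p a x n + p b y n| ≤ (q a n + q b n : ℕ) := fun n => by
    push_cast
    exact (abs_add_le _ _).trans (add_le_add (hple a x hx n) (hple b y hy n))
  have hsum : Tendsto (fun n => ((p a x n : ℝ) + p b y n) / (q a n + q b n)) atTop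
      (𝓝 (a * x + b * y)) := by
    have h1 := ((hpa a x ha).add (hpa b y hb)).div ((hqa a ha).add (hqa b hb)) (by
      rw [hab]; exact one_ne_zero)
    rw [hab, div_one, mul_comm x, mul_comm y] at h1
    refine h1.congr' ?_
    filter_upwards [eventually_gt_atTop 0] with n hn
    have hn' : (n : ℝ) ≠ 0 := by positivity
    simp only [Pi.div_apply]
    rw [← add_div, ← add_div, div_div_div_cancel_right₀ hn']
  have hΛsum : Tendsto (fun n => Λ (((p a x n : ℝ) + p b y n) / (q a n + q b n))) atTop
      (𝓝 (Λ (a * x + b * y))) :=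
    (hco _ hz).tendsto.comp (tendsto_nhdsWithin_iff.2 ⟨hsum, Eventually.of_forall fun n => by
      have := div_mem_Icc (hle12 n)
      push_cast at this
      exact this⟩)
  have hL := ((hqa a ha).mul (hΛ a x ha hx)).add ((hqa b hb).mul (hΛ b y hb hy))
  have hR := ((hqa a ha).add (hqa b hb)).mul hΛsum
  rw [hab, one_mul] at hR
  refine le_of_tendsto_of_tendsto hL hR ?_
  filter_upwards [(hqt a ha).eventually_gt_atTop 0, (hqt b hb).eventually_gt_atTop 0,
    eventually_gt_atTop 0] with n h1 h2 hn
  have hn' : (0 : ℝ) < n := by exact_mod_cast hn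
  have h3 := shape_superadditive hν h h1.ne' h2.ne' (hple a x hx n) (hple b y hy n)
  have h4 := div_le_div_of_nonneg_right h3 hn'.le
  calc _ = (q a n * Λ (p a x n / q a n) + q b n * Λ (p b y n / q b n)) / n := by ring
    _ ≤ _ := h4
    _ = _ := by ring

/-- The pause puts `Λ` strictly above the chord at the single slope `β = n / (n + 1)`, where the
chord has height `c / (n + 1)`. Concavity between `0` and `β`, and between `β` and `1`, carries the
strict inequality to every slope. -/
lemma lt_shape (hν : IsSiteLaw c ν) (hc : 0 < c) (h : IsLimitShape ν Λ)
    (hcont : ∀ α : ℝ, |α| < 1 → ContinuousAt Λ α) {α : ℝ} (hα0 : 0 < |α|) (hα1 : |α| < 1) :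
    c * (1 - |α|) < Λ α := by
  wlog h0 : 0 < α generalizing α
  · have hne := abs_pos.1 hα0
    have hneg : α < 0 := lt_of_le_of_ne (not_lt.1 h0) hne
    have := this (α := -α) (by rwa [abs_neg]) (by rwa [abs_neg]) (by linarith)
    rwa [shape_neg hν h (abs_le.1 hα1.le), abs_neg] at this
  rw [abs_of_pos h0] at hα1 ⊢
  have hconc := concaveOn_shape hν hc h hcont
  obtain ⟨n, hn, hmean⟩ := exists_meanAction_pause_lt hν hc
  have hn' : (0 : ℝ) < n := by exact_mod_cast hn
  have h1 := neg_meanAction_le_shape hν h (q := n + 1) (p := n) (by omega) (by simp)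
  set β : ℝ := n / (n + 1) with hβ
  have hβ0 : 0 < β := by positivity
  have hβ1 : β < 1 := by rw [hβ, div_lt_one (by positivity)]; linarith
  have hΛβ : c * (1 - β) < Λ β := by
    push_cast at h1
    have e : c * (1 - β) = c / (n + 1) := by rw [hβ]; field_simp; ring
    rw [e, div_lt_iff₀ (by positivity)]
    rw [← hβ] at h1
    linarith
  have m0 : (0 : ℝ) ∈ Icc (-1 : ℝ) 1 := by simp
  have m1 : (1 : ℝ) ∈ Icc (-1 : ℝ) 1 := by simp
  have mβ : β ∈ Icc (-1 : ℝ) 1 := ⟨by linarith, hβ1.le⟩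
  rcases le_total α β with hle | hle
  · have h2 := hconc.2 m0 mβ (show 0 ≤ 1 - α / β by
      rw [sub_nonneg, div_le_one hβ0]; exact hle) (show 0 ≤ α / β by positivity) (by ring)
    simp only [smul_eq_mul, shape_zero hν h, mul_zero, zero_add, div_mul_cancel₀ _ hβ0.ne'] at h2
    have h3 : α / β * (c * (1 - β)) < α / β * Λ β := by gcongr
    have e : (1 - α / β) * c + α / β * (c * (1 - β)) = c * (1 - α) := by field_simp; ring
    linarith
  · have hd : 0 < 1 - β := by linarith
    have h2 := hconc.2 mβ m1 (show 0 ≤ (1 - α) / (1 - β) by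
      have : 0 ≤ 1 - α := by linarith
      positivity) (show 0 ≤ 1 - (1 - α) / (1 - β) by
        rw [sub_nonneg, div_le_one hd]; linarith) (by ring)
    have e : (1 - α) / (1 - β) * β + (1 - (1 - α) / (1 - β)) * 1 = α := by field_simp; ring
    simp only [smul_eq_mul, e, shape_one hν h, mul_zero, add_zero] at h2
    have h3 : (1 - α) / (1 - β) * (c * (1 - β)) < (1 - α) / (1 - β) * Λ β := by
      have : 0 < (1 - α) / (1 - β) := div_pos (by linarith) hd
      gcongr
    have e2 : (1 - α) / (1 - β) * (c * (1 - β)) = c * (1 - α) := by field_simp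
    linarith

/-- An even concave function with a linear upper bound `f 0 - K |x|` has a corner at `0`. -/
lemma exists_corner {f : ℝ → ℝ} {K : ℝ} (hf : ConcaveOn ℝ (Icc (-1) 1) f)
    (heven : ∀ x ∈ Icc (-1 : ℝ) 1, f (-x) = f x) (hK : 0 < K)
    (hle : ∀ x ∈ Icc (-1 : ℝ) 1, f x ≤ f 0 - K * |x|) :
    ∃ s : ℝ, 0 < s ∧ HasDerivWithinAt f (-s) (Ici 0) 0 ∧ HasDerivWithinAt f s (Iic 0) 0 := by
  have h0 : (0 : ℝ) ∈ interior (Icc (-1 : ℝ) 1) := by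
    rw [interior_Icc]; constructor <;> norm_num
  have hd := (hf.neg.hasDerivWithinAt_rightDeriv_of_mem_interior h0).neg
  rw [neg_neg] at hd
  set s := derivWithin (-f) (Ioi 0) 0 with hs
  have hR : HasDerivWithinAt f (-s) (Ici 0) 0 := hasDerivWithinAt_Ioi_iff_Ici.1 hd
  refine ⟨s, ?_, hR, ?_⟩
  · have h1 := (hasDerivWithinAt_iff_tendsto_slope' (by simp)).1 hd
    -- Concavity provides a finite right derivative at an interior point; the linear bound keeps all
    -- right difference quotients below `-K`, so `s ≥ K`.
    have h2 : ∀ᶠ x in 𝓝[>] (0 : ℝ), slope f 0 x ≤ -K := by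
      filter_upwards [Ioo_mem_nhdsGT (show (0 : ℝ) < 1 by norm_num)] with x hx
      have h3 := hle x ⟨by linarith [hx.1], hx.2.le⟩
      rw [abs_of_pos hx.1] at h3
      rw [slope_def_field, sub_zero, div_le_iff₀ hx.1]
      linarith
    have := le_of_tendsto h1 h2
    linarith
  · have hneg : HasDerivWithinAt (fun x : ℝ => -x) (-1) (Iic 0) 0 :=
      (hasDerivAt_neg 0).hasDerivWithinAt
    have h1 : HasDerivWithinAt (fun x => f (-x)) (-s * -1) (Iic 0) 0 :=
      HasDerivWithinAt.comp (h₂ := f) (h := fun x : ℝ => -x) (s' := Ici 0) (0 : ℝ)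
        (by rwa [neg_zero]) hneg (fun x hx => by simpa using hx)
    rw [neg_mul_neg, mul_one] at h1
    refine h1.congr_of_eventuallyEq ?_ (by simp)
    filter_upwards [mem_nhdsWithin_of_mem_nhds (Icc_mem_nhds (show (-1 : ℝ) < 0 by norm_num)
      (show (0 : ℝ) < 1 by norm_num))] with x hx
    exact (heven x hx).symm

end Shape

end ProductLPP

/-! ### Transfer to the given probability space and conclusion. -/

theorem mainTheorem5 {Ω : Type*} [MeasurableSpace Ω] (P : Measure Ω) [IsProbabilityMeasure P]
    (c κ q : ℝ) (hc : 0 < c) (hκ : -1 < κ) (hq : 0 < q)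
    (ρ : ℝ → ℝ) (hρ : ProductLPP.IsSpatialDensity c κ q ρ)
    (B F : ℤ → Ω → ℝ) (hBF : ProductLPP.IsEnvironment P ρ B F) :
    ∃ Λ : ℝ → ℝ,
      ProductLPP.IsShapeFunction P B F Λ ∧
      (∀ Λ' : ℝ → ℝ, ProductLPP.IsShapeFunction P B F Λ' → EqOn Λ' Λ (Icc (-1) 1)) ∧
      Λ 0 = c ∧
      Λ 1 = 0 ∧ Λ (-1) = 0 ∧
      (∀ α : ℝ, 0 < |α| → |α| < 1 → c * (1 - |α|) < Λ α) ∧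
      (¬ ∃ a b : ℝ, ∀ α ∈ Icc (0 : ℝ) 1, Λ α = a * α + b) ∧
      (∃ K : ℝ, 0 < K ∧ ∀ α ∈ Icc (-1 : ℝ) 1, Λ α ≤ c - K * |α|) ∧
      (∃ s : ℝ, 0 < s ∧ HasDerivWithinAt Λ (-s) (Ici 0) 0 ∧
        HasDerivWithinAt Λ s (Iic 0) 0) := by
  have := hBF.isProbabilityMeasure
  have hν := hρ.isSiteLaw hc
  have hmap := hBF.map_envMap
  set ν : Measure ℝ := volume.withDensity fun y => ENNReal.ofReal (ρ y) with hνdef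
  obtain ⟨l, hl⟩ := ProductLPP.exists_ae_limitConf hν hc
  obtain ⟨Λ, hΛ⟩ := ProductLPP.exists_shape (l := l) hc
  have hcont : ∀ α : ℝ, |α| < 1 → ContinuousAt Λ α := fun α hα =>
    ProductLPP.continuousAt_shape hc hl hΛ hα
  have hshape : ProductLPP.IsLimitShape ν Λ := fun α hα => by
    filter_upwards [hl] with ω hω using hΛ α hα ω hω
  have hconc := ProductLPP.concaveOn_shape hν hc hshape hcont
  have heven : ∀ α ∈ Icc (-1 : ℝ) 1, Λ (-α) = Λ α :=
    fun α hα => ProductLPP.shape_neg hν hshape hα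
  have hzero := ProductLPP.shape_zero hν hshape
  have hone := ProductLPP.shape_one hν hshape
  have hlt : ∀ α : ℝ, 0 < |α| → |α| < 1 → c * (1 - |α|) < Λ α := fun α h0 h1 =>
    ProductLPP.lt_shape hν hc hshape hcont h0 h1
  have htend : ∀ᵐ ω ∂P, ∀ α ∈ Icc (-1 : ℝ) 1, Tendsto (fun n : ℕ =>
      ProductLPP.minAction (fun i => B i ω) (fun x => F x ω) n
        (ProductLPP.roundToZero (α * n)) / (n : ℝ))
      atTop (𝓝 (-Λ α)) := by
    rw [← hmap] at hl
    filter_upwards [ae_of_ae_map hBF.measurable_envMap.aemeasurable hl] with ω hω α hα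
    simpa only [ProductLPP.confAction, ProductLPP.envMap, Sum.elim_inl, Sum.elim_inr]
      using hΛ α hα _ hω
  refine ⟨Λ, ⟨fun α hα => ProductLPP.shape_nonneg hν hc hshape hcont hα,
    ProductLPP.continuousOn_shape hν hc hshape hcont, heven, hconc, htend⟩,
    fun Λ' hΛ' α hα => ?_, hzero, hone, by rw [heven 1 (by simp), hone], hlt, ?_,
    ⟨ProductLPP.siteGap c ν, ProductLPP.siteGap_pos hν,
      fun α hα => ProductLPP.shape_le hν hshape hα⟩, ?_⟩
  -- Two events of full probability meet, and at a common point the limits determine both functions.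
  · obtain ⟨ω, h1, h2⟩ := (htend.and hΛ'.tendsto).exists
    exact neg_injective (tendsto_nhds_unique (h2 α hα) (h1 α hα))
  -- An affine function with values `c` at `0` and `0` at `1` would equal `c / 2` at `1 / 2`,
  -- against the strict bound.
  · rintro ⟨a, b, hab⟩
    have h0 := hab 0 (by simp)
    have h1 := hab 1 (by simp)
    have h2 := hab (1 / 2) (by constructor <;> norm_num)
    have h3 := hlt (1 / 2) (by norm_num) (by rw [abs_of_pos] <;> norm_num)
    rw [abs_of_pos (by norm_num)] at h3
    linarith
  · exact ProductLPP.exists_corner hconc heven (ProductLPP.siteGap_pos hν) fun x hx => by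
      rw [hzero]; exact ProductLPP.shape_le hν hshape hx
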